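/- Let $H$ and $Z$ be real Hilbert spaces. Let $A:\mathcal D(A)\subset H\to H$ be a linear operator such that $-A$ is the infinitesimal generator of a strongly continuous semigroup of bounded linear operators on $H$. Let $F\in\mathcal C^1(H,H)$ with $F(0)=0$ and with differential $\mathrm dF:H\to\mathcal L(H)$ locally Lipschitz continuous (here and below, locally Lipschitz means Lipschitz on every bounded set), and let $\mathcal A=A+F$ with domain $\mathcal D(\mathcal A)=\mathcal D(A)$. Let $C:\mathcal D(C)\subset H\to Z$ be a linear operator with $\mathcal D(A)\subset\mathcal D(C)$. Assume that (i) there are constants $a,b>0$ with $\|Cw\|_Z\le a\|Aw\|_H+b\|w\|_H$ for all $w\in\mathcal D(A)$; (ii) $0$ is in the resolvent set of $A$; (iii) there is $\alpha>0$ with $(Ah+\mathrm dF(w)h,h)_H\ge\alpha\|h\|_H^2$ for all $w\in H$ and $h\in\mathcal D(A)$. Then $-\mathcal A$ generates a strongly continuous semigroup $\{\mathcal T_t\}_{t\ge0}$ of (nonlinear) contractions on $H$; that is, there is a strongly continuous semigroup of contractions $\mathcal T_t:H\to H$ such that, for every $w\in\mathcal D(A)$, $t\mapsto\mathcal T_tw$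 is a strong solution of $\mathrm du/\mathrm dt+\mathcal A(u)=0$ on every interval $(0,\tau)$ (absolutely continuous, with values in $\mathcal D(A)$, and satisfying the equation almost everywhere). For this semigroup, there exists a map $\mathcal M\in\mathcal C^1(H,Z)$, with $\mathrm d\mathcal M$ locally Lipschitz continuous, such that $$\mathcal M(0)=0,\qquad \mathrm d\mathcal M(w)\mathcal A(w)+Cw=0\quad\text{for all } w\in\mathcal D(A),$$ and $\mathcal M$ is given, for all $w\in H$, by $$\mathcal M(w)=-C\Big\{\lim_{\tau\to+\infty}\int_0^\tau\mathcal T_tw\,\mathrm dt\Big\}=-CA^{-1}w+CA^{-1}\int_0^{+\infty}F(\mathcal T_tw)\,\mathrm dt,$$ where the limit exists in $H$ and belongs to $\mathcal D(A)$, and the last integral converges absolutely. Each $\mathcal T_t$, $t\ge0$, is Fréchet differentiable on $H$, and for all $w,h\in H$, $$\mathrm d\mathcal M(w)h=-CA^{-1}h+CA^{-1}\int_0^{+\infty}\mathrm dF(\mathcal T_tw)\,\mathrm d\mathcal T_t(w)h\,\mathrm dt,$$ the integral being absolutely convergent. Moreover, if $F$ and $\mathrm dF$ are globally Lipschitz continuous,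 then so is $\mathrm d\mathcal M$. -/

import Mathlib

open Set Filter Topology MeasureTheory
open scoped NNReal

/-- `S` (only the times `t ≥ 0` matter) is a strongly continuous semigroup of bounded linear
operators on `H`, and its infinitesimal generator is `-A`:
`x ∈ D(A)` and `A x = y` if and only if `(S t x - x) / t → -y` as `t → 0+`. -/
structure IsC0SemigroupWithNegGenerator {H : Type*} [NormedAddCommGroup H]
    [InnerProductSpace ℝ H] (A : H →ₗ.[ℝ] H) (S : ℝ → H →L[ℝ] H) : Prop where
  zero : S 0 = ContinuousLinearMap.id ℝ H
  add : ∀ s t : ℝ, 0 ≤ s → 0 ≤ t → S (s + t) = (S s).comp (S t)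
  continuousOn : ∀ x : H, ContinuousOn (fun t : ℝ => S t x) (Ici 0)
  generator : ∀ x y : H, (∃ hx : x ∈ A.domain, A ⟨x, hx⟩ = y) ↔
    HasDerivWithinAt (fun t : ℝ => S t x) (-y) (Ici 0) 0

/-- `0` is in the resolvent set of `A`, and the bounded operator `R` is `A⁻¹`. -/
structure IsBoundedInverse {H : Type*} [NormedAddCommGroup H] [InnerProductSpace ℝ H]
    (A : H →ₗ.[ℝ] H) (R : H →L[ℝ] H) : Prop where
  mem_domain : ∀ x : H, R x ∈ A.domain
  right_inv : ∀ x : H, A ⟨R x, mem_domain x⟩ = x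
  left_inv : ∀ x : A.domain, R (A x) = x

/-- Strong solutions of `du/dt + 𝒜(u) = 0` on `(0, τ)`: `u` is absolutely continuous, takes
values in the domain `𝒟` of `𝒜`, and satisfies the equation almost everywhere. -/
structure IsStrongSolution {H : Type*} [NormedAddCommGroup H] [InnerProductSpace ℝ H]
    {𝒟 : Set H} (𝒜 : 𝒟 → H) (τ : ℝ) (u : ℝ → H) : Prop where
  absolutelyContinuous : AbsolutelyContinuousOnInterval u 0 τ
  mem_domain : ∀ t ∈ Ioo 0 τ, u t ∈ 𝒟
  equation : ∀ᵐ t ∂(volume.restrict (Ioo 0 τ)),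
    ∃ ht : u t ∈ 𝒟, HasDerivAt u (-𝒜 ⟨u t, ht⟩) t

/-- `T` (only the times `t ≥ 0` matter) is the strongly continuous semigroup of (nonlinear)
contractions on `H` generated by `-𝒜`: for initial data `w` in the domain of `𝒜`, the orbit
`t ↦ T t w` is a strong solution of `du/dt + 𝒜(u) = 0`. When the domain is dense and `𝒜` is
monotone, this determines every `T t`, `t ≥ 0`: strong solutions are determined by their initial
value, and `T t` is the continuous extension of the solution map. -/
structure IsContractionSemigroupGeneratedByNeg {H : Type*} [NormedAddCommGroup H]
    [InnerProductSpace ℝ H] {𝒟 : Set H} (𝒜 : 𝒟 → H) (T : ℝ → H → H) : Prop where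
  zero : ∀ w : H, T 0 w = w
  add : ∀ s t : ℝ, 0 ≤ s → 0 ≤ t → ∀ w : H, T (s + t) w = T s (T t w)
  contraction : ∀ t : ℝ, 0 ≤ t → ∀ w₁ w₂ : H, ‖T t w₁ - T t w₂‖ ≤ ‖w₁ - w₂‖
  continuousOn : ∀ w : H, ContinuousOn (fun t : ℝ => T t w) (Ici 0)
  strong : ∀ w ∈ 𝒟, ∀ τ : ℝ, 0 < τ → IsStrongSolution 𝒜 τ (fun t => T t w)

/-- The operator `A + F`, with the domain of `A`. -/
def semilinearOp {H : Type*} [NormedAddCommGroup H] [InnerProductSpace ℝ H]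
    (A : H →ₗ.[ℝ] H) (F : H → H) : ↥(A.domain : Set H) → H :=
  fun w => A ⟨w, w.2⟩ + F w

/-- Lipschitz continuity on every bounded subset. -/
def LipschitzOnBounded {X Y : Type*} [PseudoMetricSpace X] [PseudoMetricSpace Y]
    (f : X → Y) : Prop :=
  ∀ s : Set X, Bornology.IsBounded s → ∃ K : ℝ≥0, LipschitzOnWith K f s

/-!
The proof works with mild solutions `u t = S t (u 0) - ∫₀ᵗ S (t - s) (g s) ds` throughout; classical
regularity of orbits comes out at the end and is not used to derive any estimate.

The key tool is the decay estimate `IsMildSolution.norm_le_exp`. For the linear semigroup,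
coercivity of `A + B` (`B` any bounded operator) gives
`‖S t x‖² ≤ ‖x‖² + ∫₀ᵗ (2⟪B S s x, S s x⟫ - 2α‖S s x‖²) ds`, first for `x` in the domain and then for
all `x` by density. Together with the first-order expansion of the convolution this bounds the right
Dini derivative of `‖u t‖²` for every mild solution, with an operator `B` chosen anew at each time.
Choosing `B = dF(ξ)` with `ξ` from the mean value theorem, it shows that two solutions of the
semilinear equation approach each other at rate `α/2`. The same estimate keeps solutions of the
truncated equation in the ball where the truncation is inactive, so that they are global solutions,
bounds solutions of the linearized equation, and shows that the linearization has a quadratic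
remainder `O(‖h‖² e^{-αt/2})` (`IsMildFlow.norm_taylor_le`). Hence each `T t` is differentiable.

For `w` in the domain, `T (t + ε) w = T t (T ε w)` and the chain rule give the right derivative
`dT_t(w)(-𝒜 w)` of the orbit. It is continuous in `t`, so the orbit is `C¹`, and the mild formula puts
it in the domain of `A`. This proves existence of the generated semigroup; any other
semigroup with the same strong solutions agrees with it on the dense domain by monotonicity
(`IsStrongSolution.eq_of_eq_zero`).

Finally, `M w = CA⁻¹(-w + ∫₀^∞ F (T_t w) dt)`, where `CA⁻¹` is bounded. The exponentially decaying
remainder estimates give `dM` and its Lipschitz continuity directly. The forwarding equation holds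
since `dF(T_t w) dT_t(w) 𝒜 w = -d/dt F (T_t w)`, and the limit formula comes from integrating the
equation along an orbit and applying `A⁻¹`.
-/

/-! ### The linear semigroup -/

section Semigroup

variable {H : Type*} [NormedAddCommGroup H] [InnerProductSpace ℝ H]

/-- The family `S`, frozen at its initial value for negative times. Nothing is known about `S t`
for `t < 0`; this extension is strongly continuous on all of `ℝ`, which keeps domain
conditions out of convolution integrals. -/
def extendPos (S : ℝ → H →L[ℝ] H) (t : ℝ) : H →L[ℝ] H := S (max t 0)

lemma extendPos_of_nonneg (S : ℝ → H →L[ℝ] H) {t : ℝ} (ht : 0 ≤ t) : extendPos S t = S t := by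
  simp [extendPos, ht]

/-- `A + B` is bounded below by `α`, in the sense of the inner product. -/
def IsCoercivePerturbation (A : H →ₗ.[ℝ] H) (α : ℝ) (B : H →L[ℝ] H) : Prop :=
  ∀ h : A.domain, α * ‖(h : H)‖ ^ 2 ≤ inner ℝ (A h + B (h : H)) (h : H)

namespace IsC0SemigroupWithNegGenerator

variable {A : H →ₗ.[ℝ] H} {S : ℝ → H →L[ℝ] H}

lemma extendPos_apply_zero (hS : IsC0SemigroupWithNegGenerator A S) (x : H) :
    extendPos S 0 x = x := by
  simp [extendPos, hS.zero]

lemma continuous_extendPos_apply (hS : IsC0SemigroupWithNegGenerator A S) (x : H) :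
    Continuous fun t => extendPos S t x :=
  (hS.continuousOn x).comp_continuous (continuous_id.max continuous_const)
    fun t => le_max_right t 0

lemma exists_norm_extendPos_le [CompleteSpace H] (hS : IsC0SemigroupWithNegGenerator A S)
    (τ : ℝ) : ∃ K : ℝ≥0, ∀ t ∈ Iio τ, ‖extendPos S t‖ ≤ K := by
  have key : ∃ C, ∀ t : Icc (0 : ℝ) (max τ 0), ‖S t‖ ≤ C := by
    refine banach_steinhaus fun x => ?_
    obtain ⟨C, hC⟩ := isCompact_Icc.exists_bound_of_continuousOn
      ((hS.continuous_extendPos_apply x).continuousOn (s := Icc 0 (max τ 0)))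
    refine ⟨C, fun t => ?_⟩
    simpa [extendPos_of_nonneg S t.2.1] using hC t t.2
  obtain ⟨C, hC⟩ := key
  refine ⟨C.toNNReal, fun t ht => le_trans ?_ (Real.le_coe_toNNReal C)⟩
  exact hC ⟨max t 0, le_max_right _ _, max_le_max_right 0 (le_of_lt ht)⟩

lemma continuous_extendPos [CompleteSpace H] (hS : IsC0SemigroupWithNegGenerator A S) :
    Continuous fun p : ℝ × H => extendPos S p.1 p.2 := by
  have key : Continuous fun p : H × ℝ => extendPos S p.2 p.1 := by
    rw [continuous_iff_continuousAt]
    rintro ⟨x, t⟩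
    obtain ⟨K, hK⟩ := hS.exists_norm_extendPos_le (t + 1)
    refine (continuousOn_prod_of_continuousOn_lipschitzOnWith
      (fun p : H × ℝ => extendPos S p.2 p.1) (s := univ) (t := Iio (t + 1)) K
      (fun y _ => (hS.continuous_extendPos_apply y).continuousOn)
      (fun s hs => ?_)).continuousAt ?_
    · refine ((extendPos S s).lipschitz.weaken ?_).lipschitzOnWith
      exact_mod_cast hK s hs
    · exact prod_mem_nhds univ_mem (Iio_mem_nhds (by linarith))
  exact key.comp continuous_swap

lemma apply_add (hS : IsC0SemigroupWithNegGenerator A S) {s t : ℝ} (hs : 0 ≤ s) (ht : 0 ≤ t)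
    (x : H) : S (s + t) x = S s (S t x) := by
  rw [hS.add s t hs ht]; rfl

lemma hasDerivWithinAt_apply (hS : IsC0SemigroupWithNegGenerator A S) (x : A.domain) {t : ℝ}
    (ht : 0 ≤ t) : HasDerivWithinAt (fun s => S s (x : H)) (-(S t (A x))) (Ici t) t := by
  have h0 : HasDerivWithinAt (fun s => S s (x : H)) (-(A x)) (Ici 0) (t - t) := by
    rw [sub_self]; exact (hS.generator x (A x)).1 ⟨x.2, rfl⟩
  have h1 := h0.scomp (h := fun s => s - t) t
    ((hasDerivAt_id t).sub_const t).hasDerivWithinAt (s := Ici t)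
    (fun s hs => mem_Ici.2 (sub_nonneg.2 hs))
  have h2 := (S t).hasFDerivAt.comp_hasDerivWithinAt t h1
  rw [one_smul, map_neg] at h2
  refine h2.congr (fun s hs => ?_) ?_
  · have := hS.apply_add ht (sub_nonneg.2 (mem_Ici.1 hs)) (x : H)
    simpa using this
  · simp [hS.zero]

lemma apply_mem_domain (hS : IsC0SemigroupWithNegGenerator A S) (x : A.domain) {t : ℝ}
    (ht : 0 ≤ t) : ∃ h : S t x ∈ A.domain, A ⟨S t x, h⟩ = S t (A x) := by
  rw [hS.generator]
  have h0 := (hS.generator x (A x)).1 ⟨x.2, rfl⟩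
  have h2 := (S t).hasFDerivAt.comp_hasDerivWithinAt 0 h0
  rw [map_neg] at h2
  refine h2.congr (fun s hs => ?_) ?_
  · have hs : 0 ≤ s := hs
    simp only [Function.comp]
    rw [← hS.apply_add hs ht, ← hS.apply_add ht hs, add_comm]
  · simp [hS.zero]

lemma dense_domain [CompleteSpace H] (hS : IsC0SemigroupWithNegGenerator A S) :
    Dense (A.domain : Set H) := by
  intro x
  have hc := hS.continuous_extendPos_apply x
  set I : ℝ → H := fun t => ∫ s in (0 : ℝ)..t, extendPos S s x with hI
  have hder : ∀ t, HasDerivAt I (extendPos S t x) t := fun t =>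
    (hc.integral_hasStrictDerivAt 0 t).hasDerivAt
  have hmem : ∀ ε : ℝ, 0 < ε → I ε ∈ A.domain := by
    intro ε hε
    refine ((hS.generator (I ε) (x - extendPos S ε x)).2 ?_).1
    have h1 : HasDerivAt (fun h => I (h + ε) - I h) (extendPos S ε x - x) 0 := by
      refine HasDerivAt.sub ?_ ?_
      · have := (hder (0 + ε)).comp_add_const 0 ε
        simpa using this
      · simpa [hS.extendPos_apply_zero] using hder 0
    rw [neg_sub]
    refine h1.hasDerivWithinAt.congr (fun h hh => ?_) ?_
    · have hh : 0 ≤ h := hh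
      have e1 : S h (I ε) = ∫ s in (0 : ℝ)..ε, extendPos S (s + h) x := by
        rw [hI, ← ContinuousLinearMap.intervalIntegral_comp_comm _ (hc.intervalIntegrable _ _)]
        refine intervalIntegral.integral_congr fun s hs => ?_
        rw [uIcc_of_le hε.le] at hs
        rw [extendPos_of_nonneg S hs.1, extendPos_of_nonneg S (add_nonneg hs.1 hh), add_comm,
          hS.apply_add hh hs.1]
      rw [e1, intervalIntegral.integral_comp_add_right fun s => extendPos S s x, zero_add,
        add_comm ε h, hI, ← intervalIntegral.integral_interval_sub_left
          (hc.intervalIntegrable _ _) (hc.intervalIntegrable _ _)]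
    · simp [hI, hS.zero]
  have hlim : Tendsto (slope I 0) (𝓝[>] 0) (𝓝 x) := by
    have := (hder 0).hasDerivWithinAt (s := Ioi 0)
    rw [hasDerivWithinAt_iff_tendsto_slope' (by simp), hS.extendPos_apply_zero] at this
    exact this
  refine mem_closure_of_tendsto hlim ?_
  filter_upwards [self_mem_nhdsWithin] with ε hε
  rw [slope_def_module]
  have h0 : I 0 = 0 := by simp [hI]
  rw [h0]
  simp only [sub_zero]
  exact A.domain.smul_mem _ (hmem ε hε)

/-- The energy inequality for orbits of the linear semigroup, in integrated form: this is what
survives of coercivity for initial data outside of the domain. -/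
lemma norm_sq_apply_le [CompleteSpace H] (hS : IsC0SemigroupWithNegGenerator A S) {α : ℝ}
    {B : H →L[ℝ] H} (hB : IsCoercivePerturbation A α B) (x : H) {t : ℝ} (ht : 0 ≤ t) :
    ‖S t x‖ ^ 2 ≤ ‖x‖ ^ 2 + ∫ s in (0 : ℝ)..t, (2 * inner ℝ (B (extendPos S s x))
      (extendPos S s x) - 2 * α * ‖extendPos S s x‖ ^ 2) := by
  have hjc : Continuous fun p : H × ℝ => extendPos S p.2 p.1 :=
    hS.continuous_extendPos.comp continuous_swap
  have hpc : Continuous (Function.uncurry fun (x : H) (s : ℝ) =>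
      2 * inner ℝ (B (extendPos S s x)) (extendPos S s x) - 2 * α * ‖extendPos S s x‖ ^ 2) := by
    simp only [Function.uncurry_def]
    fun_prop
  refine hS.dense_domain.induction (P := fun x => ‖S t x‖ ^ 2 ≤ ‖x‖ ^ 2 +
    ∫ s in (0 : ℝ)..t, (2 * inner ℝ (B (extendPos S s x))
      (extendPos S s x) - 2 * α * ‖extendPos S s x‖ ^ 2)) (fun x hx => ?_) ?_ x
  · have hc : Continuous fun s : ℝ => 2 * inner ℝ (B (extendPos S s x)) (extendPos S s x)
        - 2 * α * ‖extendPos S s x‖ ^ 2 := hpc.comp (Continuous.prodMk_right x)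
    have hd : ∀ s : ℝ, HasDerivAt (fun t => ‖x‖ ^ 2 + ∫ s in (0 : ℝ)..t,
        (2 * inner ℝ (B (extendPos S s x)) (extendPos S s x) -
          2 * α * ‖extendPos S s x‖ ^ 2)) (2 * inner ℝ (B (extendPos S s x)) (extendPos S s x)
        - 2 * α * ‖extendPos S s x‖ ^ 2) s := fun s =>
      (hc.integral_hasStrictDerivAt 0 s).hasDerivAt.const_add _
    refine image_le_of_deriv_right_le_deriv_boundary (f := fun t => ‖S t x‖ ^ 2)
      (f' := fun s => 2 * inner ℝ (S s x) (-(S s (A ⟨x, hx⟩)))) (a := 0) (b := t)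
      ?_ (fun s hs => (hS.hasDerivWithinAt_apply ⟨x, hx⟩ hs.1).norm_sq) ?_
      (fun s _ => (hd s).continuousAt.continuousWithinAt)
      (fun s _ => (hd s).hasDerivWithinAt) (fun s hs => ?_) ⟨ht, le_rfl⟩
    · exact (((hS.continuousOn x).mono Icc_subset_Ici_self).norm).pow 2
    · simp [hS.zero]
    · obtain ⟨h1, h2⟩ := hS.apply_mem_domain ⟨x, hx⟩ hs.1
      have := hB ⟨S s x, h1⟩
      rw [h2] at this
      simp only [extendPos_of_nonneg S hs.1, inner_neg_right, real_inner_comm (S s (A ⟨x, hx⟩))]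
      rw [inner_add_left] at this
      simp only [real_inner_comm (S s x)] at this ⊢
      linarith
  · exact isClosed_le (by fun_prop) (by fun_prop)

lemma norm_apply_le [CompleteSpace H] (hS : IsC0SemigroupWithNegGenerator A S) {α : ℝ}
    (hα : 0 ≤ α) {B : H →L[ℝ] H} (hB : IsCoercivePerturbation A α B) {t : ℝ} (ht : 0 ≤ t)
    (x : H) : ‖S t x‖ ≤ Real.exp (‖B‖ * t) * ‖x‖ := by
  refine hS.dense_domain.induction
    (P := fun x => ‖S t x‖ ≤ Real.exp (‖B‖ * t) * ‖x‖) (fun x hx => ?_)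
    (isClosed_le (by fun_prop) (by fun_prop)) x
  have key : ‖S t x‖ ^ 2 ≤ ‖x‖ ^ 2 * Real.exp (2 * ‖B‖ * t) := by
    have := le_gronwallBound_of_liminf_deriv_right_le (f := fun t => ‖S t x‖ ^ 2)
      (f' := fun s => 2 * inner ℝ (S s x) (-(S s (A ⟨x, hx⟩)))) (a := 0) (b := t)
      (δ := ‖x‖ ^ 2) (K := 2 * ‖B‖) (ε := 0) ?_ ?_ ?_ ?_ t ⟨ht, le_rfl⟩
    · simpa [gronwallBound_ε0] using this
    · exact (((hS.continuousOn x).mono Icc_subset_Ici_self).norm).pow 2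
    · exact fun s hs r hr =>
        ((hS.hasDerivWithinAt_apply ⟨x, hx⟩ hs.1).norm_sq).liminf_right_slope_le hr
    · simp [hS.zero]
    · intro s hs
      obtain ⟨h1, h2⟩ := hS.apply_mem_domain ⟨x, hx⟩ hs.1
      have := hB ⟨S s x, h1⟩
      rw [h2, inner_add_left] at this
      have h3 : inner ℝ (B (S s x)) (S s x) ≤ ‖B‖ * ‖S s x‖ ^ 2 := by
        refine (real_inner_le_norm _ _).trans ?_
        nlinarith [B.le_opNorm (S s x), norm_nonneg (S s x)]
      have h4 : 0 ≤ α * ‖S s x‖ ^ 2 := by positivity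
      rw [inner_neg_right, real_inner_comm]
      simp only at this
      linarith
  refine le_of_sq_le_sq ?_ (by positivity)
  rw [mul_pow, ← Real.exp_nat_mul, mul_comm, Nat.cast_ofNat, ← mul_assoc]
  exact key

end IsC0SemigroupWithNegGenerator

end Semigroup

/-! ### Mild solutions and their decay -/

section Mild

variable {H : Type*} [NormedAddCommGroup H] [InnerProductSpace ℝ H]

/-- `u` is a mild solution of `u' + A u + g = 0` for `t ≥ 0`, where `-A` generates `S`. Both
functions are continuous on the whole line, although only `t ≥ 0` matters. -/
structure IsMildSolution (S : ℝ → H →L[ℝ] H) (g u : ℝ → H) : Prop where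
  continuous_source : Continuous g
  continuous : Continuous u
  eq : ∀ t, 0 ≤ t → u t = S t (u 0) - ∫ s in (0 : ℝ)..t, extendPos S (t - s) (g s)

variable {A : H →ₗ.[ℝ] H} {S : ℝ → H →L[ℝ] H} {g g₁ g₂ u u₁ u₂ : ℝ → H}

namespace IsC0SemigroupWithNegGenerator

variable [CompleteSpace H]

lemma continuous_convolution (hS : IsC0SemigroupWithNegGenerator A S) (hg : Continuous g)
    (t : ℝ) : Continuous fun s => extendPos S (t - s) (g s) :=
  hS.continuous_extendPos.comp (by fun_prop : Continuous fun s => (t - s, g s))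

lemma hasDerivAt_convolution_zero (hS : IsC0SemigroupWithNegGenerator A S) (hg : Continuous g) :
    HasDerivAt (fun t => ∫ s in (0 : ℝ)..t, extendPos S (t - s) (g s)) (g 0) 0 := by
  rw [hasDerivAt_iff_isLittleO, Asymptotics.isLittleO_iff]
  intro c hc
  have hcont : ContinuousAt (fun p : ℝ × ℝ => extendPos S (p.1 - p.2) (g p.2)) (0, 0) :=
    (hS.continuous_extendPos.comp
      (by fun_prop : Continuous fun p : ℝ × ℝ => (p.1 - p.2, g p.2))).continuousAt
  obtain ⟨δ, hδ, h⟩ := Metric.continuousAt_iff.1 hcont c hc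
  filter_upwards [Metric.ball_mem_nhds (0 : ℝ) hδ] with t ht
  have h1 : (∫ s in (0 : ℝ)..t, extendPos S (t - s) (g s)) - t • g 0 =
      ∫ s in (0 : ℝ)..t, (extendPos S (t - s) (g s) - g 0) := by
    rw [intervalIntegral.integral_sub ((hS.continuous_convolution hg t).intervalIntegrable _ _)
      (by simp)]
    simp
  simp only [intervalIntegral.integral_same, sub_zero]
  rw [h1, Real.norm_eq_abs]
  have := intervalIntegral.norm_integral_le_of_norm_le_const (a := 0) (b := t) (C := c)
    (f := fun s => extendPos S (t - s) (g s) - g 0) (fun s hs => ?_)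
  · simpa using this
  · have hs' : |s| ≤ |t| := by
      rcases le_total 0 t with h0 | h0
      · rw [uIoc_of_le h0] at hs
        rw [abs_of_nonneg hs.1.le, abs_of_nonneg h0]; exact hs.2
      · rw [uIoc_of_ge h0] at hs
        rw [abs_of_nonpos hs.2, abs_of_nonpos h0]; linarith [hs.1]
    have ht' : |t| < δ := by simpa using ht
    have := h (x := (t, s)) (by
      rw [Prod.dist_eq, max_lt_iff]; simpa using ⟨ht', hs'.trans_lt ht'⟩)
    rw [dist_eq_norm] at this
    simpa [hS.extendPos_apply_zero] using this.le

end IsC0SemigroupWithNegGenerator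

namespace IsMildSolution

lemma sub [CompleteSpace H] (hS : IsC0SemigroupWithNegGenerator A S)
    (h₁ : IsMildSolution S g₁ u₁) (h₂ : IsMildSolution S g₂ u₂) :
    IsMildSolution S (fun t => g₁ t - g₂ t) (fun t => u₁ t - u₂ t) where
  continuous_source := h₁.continuous_source.sub h₂.continuous_source
  continuous := h₁.continuous.sub h₂.continuous
  eq t ht := by
    simp only [map_sub]
    rw [h₁.eq t ht, h₂.eq t ht, intervalIntegral.integral_sub
      ((hS.continuous_convolution h₁.continuous_source t).intervalIntegrable _ _)
      ((hS.continuous_convolution h₂.continuous_source t).intervalIntegrable _ _)]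
    abel

lemma const_smul (c : ℝ) (h : IsMildSolution S g u) :
    IsMildSolution S (fun t => c • g t) (fun t => c • u t) where
  continuous_source := h.continuous_source.const_smul c
  continuous := h.continuous.const_smul c
  eq t ht := by
    simp only [map_smul]
    rw [h.eq t ht, intervalIntegral.integral_smul, smul_sub]

lemma add [CompleteSpace H] (hS : IsC0SemigroupWithNegGenerator A S)
    (h₁ : IsMildSolution S g₁ u₁) (h₂ : IsMildSolution S g₂ u₂) :
    IsMildSolution S (fun t => g₁ t + g₂ t) (fun t => u₁ t + u₂ t) := by
  simpa using h₁.sub hS (h₂.const_smul (-1))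

lemma translate [CompleteSpace H] (hS : IsC0SemigroupWithNegGenerator A S)
    (h : IsMildSolution S g u) {τ : ℝ} (hτ : 0 ≤ τ) :
    IsMildSolution S (fun t => g (τ + t)) (fun t => u (τ + t)) where
  continuous_source := h.continuous_source.comp (continuous_const.add continuous_id)
  continuous := h.continuous.comp (continuous_const.add continuous_id)
  eq t ht := by
    have hi := fun r a b => (hS.continuous_convolution h.continuous_source r).intervalIntegrable
      (μ := volume) a b
    have h1 : ∫ s in (0 : ℝ)..τ, extendPos S (τ + t - s) (g s) =
        S t (∫ s in (0 : ℝ)..τ, extendPos S (τ - s) (g s)) := by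
      rw [← ContinuousLinearMap.intervalIntegral_comp_comm _ (hi τ _ _)]
      refine intervalIntegral.integral_congr fun s hs => ?_
      rw [uIcc_of_le hτ] at hs
      rw [extendPos_of_nonneg S (by linarith [hs.2]), extendPos_of_nonneg S (by linarith [hs.2]),
        ← hS.apply_add ht (by linarith [hs.2])]
      congr 2; ring
    have h2 : ∫ s in τ..(τ + t), extendPos S (τ + t - s) (g s) =
        ∫ s in (0 : ℝ)..t, extendPos S (t - s) (g (τ + s)) := by
      have := intervalIntegral.integral_comp_add_left (a := 0) (b := t)
        (fun s => extendPos S (τ + t - s) (g s)) τ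
      rw [add_zero] at this
      rw [← this]
      refine intervalIntegral.integral_congr fun s _ => ?_
      rw [add_sub_add_left_eq_sub]
    rw [add_zero, h.eq (τ + t) (add_nonneg hτ ht), h.eq τ hτ, map_sub, ← h1, ← h2,
      ← intervalIntegral.integral_add_adjacent_intervals (hi (τ + t) 0 τ) (hi _ _ _),
      ← hS.apply_add ht hτ, add_comm t τ]
    abel

/-- Right Dini derivative of the squared norm of a mild solution, at the initial time. It is
controlled by coercivity even though `u 0` may be outside of the domain of `A`. -/
lemma eventually_norm_sq_lt [CompleteSpace H] (hS : IsC0SemigroupWithNegGenerator A S)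
    (h : IsMildSolution S g u) {α : ℝ} {B : H →L[ℝ] H} (hB : IsCoercivePerturbation A α B)
    {r : ℝ} (hr : 2 * inner ℝ (B (u 0)) (u 0) - 2 * α * ‖u 0‖ ^ 2
      - 2 * inner ℝ (u 0) (g 0) < r) :
    ∀ᶠ ε in 𝓝[>] (0 : ℝ), ε⁻¹ * (‖u ε‖ ^ 2 - ‖u 0‖ ^ 2) < r := by
  set x := u 0
  set J : ℝ → H := fun t => ∫ s in (0 : ℝ)..t, extendPos S (t - s) (g s)
  have hJ0 : J 0 = 0 := by simp [J]
  set p : ℝ → ℝ := fun s => 2 * inner ℝ (B (extendPos S s x)) (extendPos S s x)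
    - 2 * α * ‖extendPos S s x‖ ^ 2
  have hSc := hS.continuous_extendPos_apply x
  have hpc : Continuous p := by fun_prop
  have hJ : Tendsto (fun ε : ℝ => ε⁻¹ • J ε) (𝓝[>] 0) (𝓝 (g 0)) := by
    have := (hS.hasDerivAt_convolution_zero h.continuous_source).hasDerivWithinAt (s := Ioi 0)
    rw [hasDerivWithinAt_iff_tendsto_slope' (by simp)] at this
    refine this.congr fun ε => ?_
    simp [slope_def_module, J]
  have hJ' : Tendsto J (𝓝[>] 0) (𝓝 0) := by
    have := (hS.hasDerivAt_convolution_zero h.continuous_source).continuousAt.tendsto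
    rw [show (∫ s in (0 : ℝ)..0, extendPos S (0 - s) (g s)) = 0 by simp] at this
    exact this.mono_left nhdsWithin_le_nhds
  have hP : Tendsto (fun ε : ℝ => ε⁻¹ * ∫ s in (0 : ℝ)..ε, p s) (𝓝[>] 0) (𝓝 (p 0)) := by
    have := (hpc.integral_hasStrictDerivAt 0 0).hasDerivAt.hasDerivWithinAt (s := Ioi 0)
    rw [hasDerivWithinAt_iff_tendsto_slope' (by simp)] at this
    refine this.congr fun ε => ?_
    simp [slope_def_module]
  have hS0 : Tendsto (fun ε => extendPos S ε x) (𝓝[>] 0) (𝓝 x) := by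
    have := hSc.tendsto 0
    rw [hS.extendPos_apply_zero] at this
    exact this.mono_left nhdsWithin_le_nhds
  have hlim : Tendsto (fun ε : ℝ => (ε⁻¹ * ∫ s in (0 : ℝ)..ε, p s)
      - 2 * inner ℝ (extendPos S ε x) (ε⁻¹ • J ε) + inner ℝ (J ε) (ε⁻¹ • J ε)) (𝓝[>] 0)
      (𝓝 (p 0 - 2 * inner ℝ x (g 0) + inner ℝ (0 : H) (g 0))) :=
    (hP.sub ((hS0.inner hJ).const_mul 2)).add (hJ'.inner hJ)
  have hp0 : p 0 - 2 * inner ℝ x (g 0) + inner ℝ (0 : H) (g 0) < r := by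
    simpa [p, hS.extendPos_apply_zero] using hr
  filter_upwards [hlim.eventually_lt_const hp0, self_mem_nhdsWithin] with ε h1 h2
  have hε : 0 < ε := h2
  refine lt_of_le_of_lt ?_ h1
  have h3 := hS.norm_sq_apply_le hB x hε.le
  have h4 : ‖u ε‖ ^ 2 = ‖S ε x‖ ^ 2 - 2 * inner ℝ (S ε x) (J ε) + ‖J ε‖ ^ 2 := by
    rw [h.eq ε hε.le, norm_sub_sq_real]
  rw [inner_smul_right, inner_smul_right, extendPos_of_nonneg S hε.le, h4,
    real_inner_self_eq_norm_sq]
  have : ε⁻¹ * (‖S ε x‖ ^ 2 - 2 * inner ℝ (S ε x) (J ε) + ‖J ε‖ ^ 2 - ‖x‖ ^ 2) ≤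
      ε⁻¹ * ((∫ s in (0 : ℝ)..ε, p s) - 2 * inner ℝ (S ε x) (J ε) + ‖J ε‖ ^ 2) := by
    gcongr
    linarith
  refine this.trans_eq ?_
  ring

/-- Decay of mild solutions. If, whenever `‖u t‖` reaches the barrier `κ e^{-αt/2}`, the source
`g t` dominates in the direction `u t` a coercive linear source `B (u t)`, up to an error
`(α/4) ‖u t‖²`, then the barrier is never crossed. The operator `B` may depend on `t`
arbitrarily, and nothing is required away from the barrier. -/
theorem norm_le_exp [CompleteSpace H] (hS : IsC0SemigroupWithNegGenerator A S)
    (h : IsMildSolution S g u) {α : ℝ} (hα : 0 < α) {κ : ℝ} (hκ : 0 < κ) (h0 : ‖u 0‖ ≤ κ)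
    (hB : ∀ t, 0 ≤ t → ∃ B : H →L[ℝ] H, IsCoercivePerturbation A α B ∧
      (‖u t‖ = κ * Real.exp (-(α / 2) * t) →
        inner ℝ (B (u t)) (u t) ≤ inner ℝ (g t) (u t) + α / 4 * ‖u t‖ ^ 2))
    {t : ℝ} (ht : 0 ≤ t) : ‖u t‖ ≤ κ * Real.exp (-(α / 2) * t) := by
  choose! B hB1 hB2 using hB
  have hexp : ∀ t, (κ * Real.exp (-(α / 2) * t)) ^ 2 = κ ^ 2 * Real.exp (-α * t) := by
    intro t
    rw [mul_pow, ← Real.exp_nat_mul]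
    congr 2
    push_cast
    ring
  refine le_of_sq_le_sq ?_ (by positivity)
  rw [hexp]
  have hder : ∀ t, HasDerivAt (fun t => κ ^ 2 * Real.exp (-α * t))
      (κ ^ 2 * (Real.exp (-α * t) * (-α))) t := fun t => by
    simpa using (((hasDerivAt_id t).const_mul (-α)).exp).const_mul (κ ^ 2)
  refine image_le_of_liminf_slope_right_lt_deriv_boundary' (f := fun t => ‖u t‖ ^ 2)
    (f' := fun t => 2 * inner ℝ (B t (u t)) (u t) - 2 * α * ‖u t‖ ^ 2
      - 2 * inner ℝ (u t) (g t)) (a := 0) (b := t) (h.continuous.norm.pow 2).continuousOn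
    (fun s hs r hr => ?_) ?_ (fun s _ => (hder s).continuousAt.continuousWithinAt)
    (fun s _ => (hder s).hasDerivWithinAt) (fun s hs he => ?_) ⟨ht, le_rfl⟩
  · have h1 := (h.translate hS hs.1).eventually_norm_sq_lt hS (hB1 s hs.1) (r := r)
      (by simpa using hr)
    have h2 : Tendsto (fun z => z - s) (𝓝[>] s) (𝓝[>] 0) := by
      refine tendsto_nhdsWithin_iff.2 ⟨?_, ?_⟩
      · have : Tendsto (fun z => z - s) (𝓝 s) (𝓝 (s - s)) := tendsto_id.sub_const s
        rw [sub_self] at this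
        exact this.mono_left nhdsWithin_le_nhds
      · filter_upwards [self_mem_nhdsWithin] with z hz
        exact mem_Ioi.2 (sub_pos.2 (mem_Ioi.1 hz))
    refine (h2.eventually h1).frequently.mono fun z hz => ?_
    simpa [slope_def_field, div_eq_inv_mul] using hz
  · simp only [mul_zero, Real.exp_zero, mul_one]
    gcongr
  · have he' : ‖u s‖ = κ * Real.exp (-(α / 2) * s) := by
      have := he.trans (hexp s).symm
      exact (sq_eq_sq₀ (norm_nonneg _) (by positivity)).1 this
    have h1 := hB2 s hs.1 he'
    have h2 : 0 < ‖u s‖ ^ 2 := by rw [he']; positivity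
    have h3 : κ ^ 2 * (Real.exp (-α * s) * (-α)) = -α * ‖u s‖ ^ 2 := by
      have he : ‖u s‖ ^ 2 = κ ^ 2 * Real.exp (-α * s) := he
      rw [he]; ring
    rw [h3, real_inner_comm (g s)]
    nlinarith

/-- The form of `IsMildSolution.norm_le_exp` for sources that are a coercive linear term plus an
exponentially small error. -/
theorem norm_le_exp_of_inner_le [CompleteSpace H] (hS : IsC0SemigroupWithNegGenerator A S)
    (h : IsMildSolution S g u) {α : ℝ} (hα : 0 < α) {κ : ℝ} (hκ : 0 ≤ κ) (h0 : ‖u 0‖ ≤ κ)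
    (hB : ∀ t, 0 ≤ t → ∃ B : H →L[ℝ] H, IsCoercivePerturbation A α B ∧
      inner ℝ (B (u t)) (u t) ≤ inner ℝ (g t) (u t) +
        α / 4 * (κ * Real.exp (-(α / 2) * t)) * ‖u t‖)
    {t : ℝ} (ht : 0 ≤ t) : ‖u t‖ ≤ κ * Real.exp (-(α / 2) * t) := by
  rw [← div_le_iff₀ (Real.exp_pos _)]
  refine le_of_forall_gt_imp_ge_of_dense fun κ' hκ' => ?_
  rw [div_le_iff₀ (Real.exp_pos _)]
  refine h.norm_le_exp hS hα (hκ.trans_lt hκ') (h0.trans hκ'.le) (fun s hs => ?_) ht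
  obtain ⟨B, hB1, hB2⟩ := hB s hs
  refine ⟨B, hB1, fun he => hB2.trans ?_⟩
  rw [sq, mul_assoc]
  gcongr
  rw [he]
  gcongr

end IsMildSolution

end Mild

/-! ### Global existence of mild solutions for Lipschitz sources -/

section Existence

variable {H : Type*} [NormedAddCommGroup H] [InnerProductSpace ℝ H]
  {A : H →ₗ.[ℝ] H} {S : ℝ → H →L[ℝ] H}

lemma integral_exp_neg_mul_sub_le {μ : ℝ} (hμ : 0 < μ) (t : ℝ) :
    ∫ s in (0 : ℝ)..t, Real.exp (-μ * (t - s)) ≤ 1 / μ := by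
  have hd : ∀ s ∈ uIcc 0 t, HasDerivAt (fun s => Real.exp (-μ * (t - s)) / μ)
      (Real.exp (-μ * (t - s))) s := by
    intro s _
    have := ((((hasDerivAt_id s).const_sub t).const_mul (-μ)).exp).div_const μ
    refine this.congr_deriv ?_
    rw [mul_neg, mul_one, neg_neg, mul_div_assoc, div_self hμ.ne', mul_one, id]
  rw [intervalIntegral.integral_eq_sub_of_hasDerivAt hd
    ((by fun_prop : Continuous fun s => Real.exp (-μ * (t - s))).intervalIntegrable _ _)]
  have : 0 ≤ Real.exp (-μ * (t - 0)) / μ := by positivity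
  simp only [sub_self, mul_zero, Real.exp_zero]
  linarith

namespace IsC0SemigroupWithNegGenerator

/-- The weighted semigroup `e^{-λ t} S t` decays at rate `λ - ω`. -/
lemma norm_weighted_apply_le {ω l : ℝ}
    (hω : ∀ t, 0 ≤ t → ∀ x, ‖S t x‖ ≤ Real.exp (ω * t) * ‖x‖) {t : ℝ} (ht : 0 ≤ t) (x : H) :
    ‖Real.exp (-l * t) • extendPos S t x‖ ≤ Real.exp (-(l - ω) * t) * ‖x‖ := by
  rw [norm_smul, Real.norm_eq_abs, Real.abs_exp, extendPos_of_nonneg S ht]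
  calc _ ≤ Real.exp (-l * t) * (Real.exp (ω * t) * ‖x‖) := by gcongr; exact hω t ht x
    _ = _ := by rw [← mul_assoc, ← Real.exp_add]; ring_nf

lemma norm_weighted_convolution_le {ω l : ℝ}
    (hω : ∀ t, 0 ≤ t → ∀ x, ‖S t x‖ ≤ Real.exp (ω * t) * ‖x‖) (hl : ω < l) {f : ℝ → H}
    {c : ℝ} (hc : 0 ≤ c) (hf : ∀ s, ‖f s‖ ≤ c) {t : ℝ} (ht : 0 ≤ t) :
    ‖∫ s in (0 : ℝ)..t, Real.exp (-l * (t - s)) • extendPos S (t - s) (f s)‖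
      ≤ c / (l - ω) := by
  have h1 : ‖∫ s in (0 : ℝ)..t, Real.exp (-l * (t - s)) • extendPos S (t - s) (f s)‖ ≤
      ∫ s in (0 : ℝ)..t, Real.exp (-(l - ω) * (t - s)) * c := by
    refine intervalIntegral.norm_integral_le_of_norm_le ht (ae_of_all _ fun s hs => ?_)
      ((by fun_prop : Continuous fun s => Real.exp (-(l - ω) * (t - s)) * c).intervalIntegrable
        _ _)
    refine (norm_weighted_apply_le hω (sub_nonneg.2 hs.2) _).trans ?_
    gcongr
    exact hf s
  refine h1.trans ?_
  rw [intervalIntegral.integral_mul_const]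
  calc _ ≤ 1 / (l - ω) * c := by
        gcongr
        exact integral_exp_neg_mul_sub_le (sub_pos.2 hl) t
    _ = _ := by ring

variable [CompleteSpace H]

/-- Global mild solutions for a source `G t x` that is Lipschitz in `x`, uniformly in `t`, and
vanishes at `x = 0`. The Picard map is a contraction on bounded functions after multiplication
by the weight `e^{-λ t}`, with `λ` large. -/
theorem exists_isMildSolution (hS : IsC0SemigroupWithNegGenerator A S) {ω : ℝ}
    (hω : ∀ t, 0 ≤ t → ∀ x, ‖S t x‖ ≤ Real.exp (ω * t) * ‖x‖) {G : ℝ → H → H}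
    (hG : Continuous fun p : ℝ × H => G p.1 p.2) {K : ℝ} (hK : 0 ≤ K)
    (hLip : ∀ t x y, ‖G t x - G t y‖ ≤ K * ‖x - y‖) (hG0 : ∀ t, G t 0 = 0) (w : H) :
    ∃ u : ℝ → H, u 0 = w ∧ IsMildSolution S (fun t => G t (u t)) u := by
  set l : ℝ := ω + (2 * K + 1) with hl
  have hlω : l - ω = 2 * K + 1 := by rw [hl]; ring
  have hlt : ω < l := by linarith
  -- the source, conjugated by the weight
  set N : ℝ → H → H := fun s x => Real.exp (-l * s) • G s (Real.exp (l * s) • x) with hN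
  have hNLip : ∀ s x y, ‖N s x - N s y‖ ≤ K * ‖x - y‖ := by
    intro s x y
    rw [hN]
    simp only
    rw [← smul_sub, norm_smul, Real.norm_eq_abs, Real.abs_exp]
    calc _ ≤ Real.exp (-l * s) * (K * ‖Real.exp (l * s) • x - Real.exp (l * s) • y‖) := by
          gcongr; exact hLip _ _ _
      _ = (Real.exp (-l * s) * Real.exp (l * s)) * (K * ‖x - y‖) := by
          rw [← smul_sub, norm_smul, Real.norm_eq_abs, Real.abs_exp]; ring
      _ = _ := by rw [← Real.exp_add]; simp
  have hN0 : ∀ s, N s 0 = 0 := fun s => by simp [hN, hG0]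
  have hNc : Continuous fun p : ℝ × H => N p.1 p.2 := by
    have : Continuous fun p : ℝ × H => G p.1 (Real.exp (l * p.1) • p.2) :=
      hG.comp (by fun_prop : Continuous fun p : ℝ × H => (p.1, Real.exp (l * p.1) • p.2))
    simp only [hN]
    fun_prop
  set Ψ : (ℝ → H) → ℝ → H := fun v t => Real.exp (-l * max t 0) • extendPos S (max t 0) w -
    ∫ s in (0 : ℝ)..max t 0, Real.exp (-l * (max t 0 - s)) • extendPos S (max t 0 - s) (N s (v s))
    with hΨ
  have hNv : ∀ v : BoundedContinuousFunction ℝ H, Continuous fun s => N s (v s) := fun v =>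
    hNc.comp (by fun_prop : Continuous fun s => (s, v s))
  have hint : ∀ (v : BoundedContinuousFunction ℝ H), Continuous fun p : ℝ × ℝ =>
      Real.exp (-l * (max p.1 0 - p.2)) • extendPos S (max p.1 0 - p.2) (N p.2 (v p.2)) := by
    intro v
    have h1 := hNv v
    have h2 : Continuous fun p : ℝ × ℝ => extendPos S (max p.1 0 - p.2) (N p.2 (v p.2)) :=
      hS.continuous_extendPos.comp
        (by fun_prop : Continuous fun p : ℝ × ℝ => (max p.1 0 - p.2, N p.2 (v p.2)))
    fun_prop
  have hΨc : ∀ v : BoundedContinuousFunction ℝ H, Continuous (Ψ v) := by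
    intro v
    have h1 : Continuous fun t : ℝ => extendPos S (max t 0) w :=
      (hS.continuous_extendPos_apply w).comp (by fun_prop)
    have h2 := intervalIntegral.continuous_parametric_intervalIntegral_of_continuous
      (μ := volume) (a₀ := 0)
      (f := fun t s => Real.exp (-l * (max t 0 - s)) • extendPos S (max t 0 - s) (N s (v s)))
      (hint v) (s := fun t : ℝ => max t 0) (by fun_prop)
    simp only [hΨ]
    fun_prop
  have hΨb : ∀ (v : BoundedContinuousFunction ℝ H) t,
      ‖Ψ v t‖ ≤ ‖w‖ + K * ‖v‖ / (l - ω) := by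
    intro v t
    refine (norm_sub_le _ _).trans (add_le_add ?_ ?_)
    · refine (norm_weighted_apply_le hω (le_max_right t 0) w).trans ?_
      refine mul_le_of_le_one_left (norm_nonneg _) (Real.exp_le_one_iff.2 ?_)
      have := le_max_right t 0
      nlinarith
    · refine norm_weighted_convolution_le hω hlt (by positivity) (fun s => ?_)
        (le_max_right t 0)
      have := hNLip s (v s) 0
      rw [hN0, sub_zero, sub_zero] at this
      refine this.trans ?_
      gcongr
      exact v.norm_coe_le_norm s
  set Φ : BoundedContinuousFunction ℝ H → BoundedContinuousFunction ℝ H := fun v =>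
    BoundedContinuousFunction.ofNormedAddCommGroup (Ψ v) (hΨc v) _ (hΨb v) with hΦ
  have hcontr : ContractingWith (1 / 2) Φ := by
    refine ⟨by rw [← NNReal.coe_lt_coe]; norm_num, LipschitzWith.of_dist_le_mul fun v₁ v₂ => ?_⟩
    rw [BoundedContinuousFunction.dist_le (by positivity)]
    intro t
    have h1 : Φ v₁ t - Φ v₂ t = -∫ s in (0 : ℝ)..max t 0, Real.exp (-l * (max t 0 - s)) •
        extendPos S (max t 0 - s) (N s (v₁ s) - N s (v₂ s)) := by
      have hi := fun v => ((hint v).comp (Continuous.prodMk_right t)).intervalIntegrable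
        (μ := volume) 0 (max t 0)
      simp only [Function.comp_def] at hi
      simp only [map_sub, smul_sub]
      rw [intervalIntegral.integral_sub (hi v₁) (hi v₂)]
      simp only [hΦ, hΨ, BoundedContinuousFunction.coe_ofNormedAddCommGroup]
      abel
    rw [dist_eq_norm, h1, norm_neg]
    refine (norm_weighted_convolution_le hω hlt (c := K * dist v₁ v₂) (by positivity)
      (fun s => ?_) (le_max_right t 0)).trans ?_
    · refine (hNLip s _ _).trans ?_
      gcongr
      rw [← dist_eq_norm]
      exact BoundedContinuousFunction.dist_coe_le_dist s
    · rw [hlω, div_le_iff₀ (by positivity)]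
      have : 0 ≤ dist v₁ v₂ := dist_nonneg
      push_cast
      nlinarith
  obtain ⟨v, hv⟩ : ∃ v, Φ v = v := ⟨_, hcontr.fixedPoint_isFixedPt⟩
  have hv' : ∀ t, 0 ≤ t → v t = Real.exp (-l * t) • extendPos S t w -
      ∫ s in (0 : ℝ)..t, Real.exp (-l * (t - s)) • extendPos S (t - s) (N s (v s)) := by
    intro t ht
    conv_lhs => rw [← hv]
    simp only [hΦ, hΨ, BoundedContinuousFunction.coe_ofNormedAddCommGroup, max_eq_left ht]
  have hv0 : v 0 = w := by
    rw [hv' 0 le_rfl]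
    simp [hS.extendPos_apply_zero]
  have huc : Continuous fun t => Real.exp (l * t) • v t := by fun_prop
  refine ⟨fun t => Real.exp (l * t) • v t, by simp [hv0],
    hG.comp (by fun_prop : Continuous fun t => (t, Real.exp (l * t) • v t)), huc, ?_⟩
  intro t ht
  rw [hv' t ht, smul_sub, smul_smul, ← Real.exp_add, ← intervalIntegral.integral_smul]
  congr 1
  · rw [extendPos_of_nonneg S ht]
    simp [hv0]
  · refine intervalIntegral.integral_congr fun s _ => ?_
    simp only [hN, map_smul, smul_smul, ← Real.exp_add]
    rw [show l * t + (-l * (t - s) + -l * s) = 0 by ring, Real.exp_zero, one_smul]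

end IsC0SemigroupWithNegGenerator

end Existence

/-! ### Taylor estimates on convex sets -/

section Taylor

variable {H : Type*} [NormedAddCommGroup H] [InnerProductSpace ℝ H] {F : H → H}

lemma exists_inner_fderiv_eq (hF : Differentiable ℝ F) (x y : H) :
    ∃ ξ, inner ℝ (fderiv ℝ F ξ (x - y)) (x - y) = inner ℝ (F x - F y) (x - y) := by
  have hd : ∀ s : ℝ, HasDerivAt (fun s : ℝ => inner ℝ (F (y + s • (x - y))) (x - y))
      (inner ℝ (fderiv ℝ F (y + s • (x - y)) (x - y)) (x - y)) s := by
    intro s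
    have h1 : HasDerivAt (fun s : ℝ => y + s • (x - y)) (x - y) s := by
      simpa using ((hasDerivAt_id s).smul_const (x - y)).const_add y
    have h2 := (hF (y + s • (x - y))).hasFDerivAt.comp_hasDerivAt s h1
    simpa using h2.inner ℝ (hasDerivAt_const s (x - y))
  obtain ⟨c, -, hc⟩ := exists_hasDerivAt_eq_slope _ _ zero_lt_one
    (fun s _ => (hd s).continuousAt.continuousWithinAt) (fun s _ => hd s)
  refine ⟨y + c • (x - y), hc.trans ?_⟩
  simp [inner_sub_left]

/-- On the convex set `s` the differential of `F` is bounded by `K` and `L`-Lipschitz. With `s`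
a ball this expresses the local hypotheses on `F`, with `s = univ` the global ones. -/
structure HasC11BoundsOn (F : H → H) (s : Set H) (K L : ℝ) : Prop where
  convex : Convex ℝ s
  nonneg_fst : 0 ≤ K
  nonneg_snd : 0 ≤ L
  norm_fderiv_le : ∀ x ∈ s, ‖fderiv ℝ F x‖ ≤ K
  norm_fderiv_sub_le : ∀ x ∈ s, ∀ y ∈ s, ‖fderiv ℝ F x - fderiv ℝ F y‖ ≤ L * ‖x - y‖

namespace HasC11BoundsOn

variable {s : Set H} {K L : ℝ}

lemma norm_sub_le (h : HasC11BoundsOn F s K L) (hF : Differentiable ℝ F) {x y : H} (hx : x ∈ s)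
    (hy : y ∈ s) : ‖F x - F y‖ ≤ K * ‖x - y‖ :=
  h.convex.norm_image_sub_le_of_norm_fderiv_le (𝕜 := ℝ) (fun z _ => hF z) h.norm_fderiv_le hy hx

lemma norm_taylor_le (h : HasC11BoundsOn F s K L) (hF : Differentiable ℝ F) {x y : H}
    (hx : x ∈ s) (hy : y ∈ s) : ‖F x - F y - fderiv ℝ F y (x - y)‖ ≤ L * ‖x - y‖ ^ 2 := by
  have := (convex_segment y x).norm_image_sub_le_of_norm_fderiv_le' (𝕜 := ℝ) (f := F)
    (φ := fderiv ℝ F y) (C := L * ‖x - y‖) (fun z _ => hF z) (fun z hz => ?_)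
    (left_mem_segment ℝ y x) (right_mem_segment ℝ y x)
  · rwa [mul_assoc, ← sq] at this
  · refine (h.norm_fderiv_sub_le z (h.convex.segment_subset hy hx hz) y hy).trans ?_
    have h1 := h.nonneg_snd
    gcongr
    exact (norm_sub_le_of_mem_segment hz)

end HasC11BoundsOn

lemma LipschitzOnBounded.exists_hasC11BoundsOn (hdF : LipschitzOnBounded (fderiv ℝ F)) (r : ℝ) :
    ∃ K L, HasC11BoundsOn F (Metric.closedBall 0 r) K L := by
  obtain ⟨L, hL⟩ := hdF (Metric.closedBall 0 r) Metric.isBounded_closedBall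
  have hL' : ∀ x ∈ Metric.closedBall (0 : H) r, ∀ y ∈ Metric.closedBall (0 : H) r,
      ‖fderiv ℝ F x - fderiv ℝ F y‖ ≤ L * ‖x - y‖ := fun x hx y hy => by
    simpa only [dist_eq_norm] using hL.dist_le_mul x hx y hy
  refine ⟨‖fderiv ℝ F 0‖ + L * |r|, L, convex_closedBall _ _, by positivity, L.2,
    fun x hx => ?_, hL'⟩
  have hx' : ‖x‖ ≤ r := by simpa using hx
  have h0 : (0 : H) ∈ Metric.closedBall (0 : H) r := by simpa using (norm_nonneg x).trans hx'
  have h1 := hL' x hx 0 h0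
  rw [sub_zero] at h1
  have h2 : (L : ℝ) * ‖x‖ ≤ L * |r| := by
    gcongr
    exact hx'.trans (le_abs_self r)
  linarith [norm_le_norm_add_norm_sub' (fderiv ℝ F x) (fderiv ℝ F 0)]

end Taylor

/-! ### The nonlinear semigroup -/

section Flow

section Cutoff

variable {H : Type*} [NormedAddCommGroup H]

/-- Piecewise linear cutoff in the radial direction: `1` on the ball of radius `r`, `0` outside of
the ball of radius `r + 1`. -/
noncomputable def radialCutoff (r : ℝ) (x : H) : ℝ := max 0 (min 1 (r + 1 - ‖x‖))

lemma radialCutoff_nonneg (r : ℝ) (x : H) : 0 ≤ radialCutoff r x := le_max_left _ _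

lemma radialCutoff_le_one (r : ℝ) (x : H) : radialCutoff r x ≤ 1 :=
  max_le zero_le_one (min_le_left _ _)

lemma radialCutoff_eq_one {r : ℝ} {x : H} (hx : ‖x‖ ≤ r) : radialCutoff r x = 1 := by
  rw [radialCutoff, min_eq_left (by linarith), max_eq_right zero_le_one]

lemma radialCutoff_eq_zero {r : ℝ} {x : H} (hx : r + 1 < ‖x‖) : radialCutoff r x = 0 := by
  rw [radialCutoff, max_eq_left]
  exact (min_le_right _ _).trans (by linarith)

lemma abs_radialCutoff_sub_le (r : ℝ) (x y : H) :
    |radialCutoff r x - radialCutoff r y| ≤ ‖x - y‖ := by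
  refine le_trans ?_ (abs_norm_sub_norm_le x y)
  refine (abs_max_sub_max_le_max _ _ _ _).trans ?_
  rw [sub_self, abs_zero, max_eq_right (abs_nonneg _)]
  refine (abs_min_sub_min_le_max _ _ _ _).trans ?_
  rw [sub_self, abs_zero, max_eq_right (abs_nonneg _), abs_sub_comm]
  ring_nf
  exact le_rfl

end Cutoff

variable {H : Type*} [NormedAddCommGroup H] [InnerProductSpace ℝ H]
  {A : H →ₗ.[ℝ] H} {S : ℝ → H →L[ℝ] H} {F : H → H} {α : ℝ}

lemma norm_radialCutoff_smul_sub_le (hF0 : F 0 = 0) (hF : Differentiable ℝ F) {r K L : ℝ}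
    (hr : 0 ≤ r) (h : HasC11BoundsOn F (Metric.closedBall 0 (r + 1)) K L) (x y : H) :
    ‖radialCutoff r x • F x - radialCutoff r y • F y‖ ≤ (K + K * (r + 1)) * ‖x - y‖ := by
  have hK := h.nonneg_fst
  have hbound : ∀ y : H, ‖y‖ ≤ r + 1 → ‖F y‖ ≤ K * (r + 1) := by
    intro y hy
    have := h.norm_sub_le hF (x := y) (y := 0) (by simpa using hy) (by simp; linarith)
    rw [hF0, sub_zero, sub_zero] at this
    exact this.trans (by gcongr)
  -- at least one of the two points may be assumed to lie in the ball
  have key : ∀ x y : H, ‖y‖ ≤ r + 1 →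
      ‖radialCutoff r x • F x - radialCutoff r y • F y‖ ≤ (K + K * (r + 1)) * ‖x - y‖ := by
    intro x y hy
    have h2 : ‖(radialCutoff r x - radialCutoff r y) • F y‖ ≤ ‖x - y‖ * (K * (r + 1)) := by
      rw [norm_smul]
      gcongr
      · exact abs_radialCutoff_sub_le r x y
      · exact hbound y hy
    rcases le_or_gt ‖x‖ (r + 1) with hx | hx
    · have h1 : ‖radialCutoff r x • (F x - F y)‖ ≤ 1 * (K * ‖x - y‖) := by
        rw [norm_smul, Real.norm_eq_abs, abs_of_nonneg (radialCutoff_nonneg r x)]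
        gcongr
        · exact radialCutoff_le_one r x
        · exact h.norm_sub_le hF (by simpa using hx) (by simpa using hy)
      have h3 : radialCutoff r x • F x - radialCutoff r y • F y =
          radialCutoff r x • (F x - F y) + (radialCutoff r x - radialCutoff r y) • F y := by
        rw [smul_sub, sub_smul]; abel
      rw [h3]
      refine (norm_add_le _ _).trans ((add_le_add h1 h2).trans_eq ?_)
      ring
    · have h3 : radialCutoff r x • F x - radialCutoff r y • F y =
          (radialCutoff r x - radialCutoff r y) • F y := by
        rw [radialCutoff_eq_zero hx]; simp
      rw [h3]
      refine h2.trans ?_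
      have : 0 ≤ K * ‖x - y‖ := by positivity
      nlinarith
  rcases le_or_gt ‖y‖ (r + 1) with hy | hy
  · exact key x y hy
  rcases le_or_gt ‖x‖ (r + 1) with hx | hx
  · rw [norm_sub_rev, norm_sub_rev x y]
    exact key y x hx
  · rw [radialCutoff_eq_zero hx, radialCutoff_eq_zero hy]
    simp only [zero_smul, sub_zero, norm_zero]
    positivity

lemma mul_exp_neg_le {c t : ℝ} (hα : 0 < α) (hc : 0 ≤ c) (ht : 0 ≤ t) :
    c * Real.exp (-(α / 2) * t) ≤ c :=
  mul_le_of_le_one_right hc (Real.exp_le_one_iff.2 (by nlinarith))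

/-- The standing hypotheses on the equation `u' + A u + F u = 0`: `-A` generates the semigroup `S`,
and `A + dF(w)` is coercive with constant `α > 0`, uniformly in `w`. -/
structure IsCoerciveSemilinear (A : H →ₗ.[ℝ] H) (S : ℝ → H →L[ℝ] H) (F : H → H) (α : ℝ) :
    Prop where
  semigroup : IsC0SemigroupWithNegGenerator A S
  pos : 0 < α
  contDiff : ContDiff ℝ 1 F
  lipschitz_fderiv : LipschitzOnBounded (fderiv ℝ F)
  map_zero : F 0 = 0
  coercive : ∀ w, IsCoercivePerturbation A α (fderiv ℝ F w)

lemma IsCoerciveSemilinear.differentiable (hP : IsCoerciveSemilinear A S F α) :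
    Differentiable ℝ F :=
  hP.contDiff.differentiable one_ne_zero

/-- `T` is the flow of mild solutions of `u' + A u + F u = 0`. Orbits are frozen at negative
times, where nothing is known about `T`. -/
structure IsMildFlow (S : ℝ → H →L[ℝ] H) (F : H → H) (T : ℝ → H → H) : Prop where
  zero : ∀ w, T 0 w = w
  mild : ∀ w, IsMildSolution S (fun t => F (T (max t 0) w)) (fun t => T (max t 0) w)

lemma IsMildFlow.continuousOn {T : ℝ → H → H} (hT : IsMildFlow S F T) (w : H) :
    ContinuousOn (fun t => T t w) (Ici 0) :=
  (hT.mild w).continuous.continuousOn.congr fun t ht => by simp only [max_eq_left (mem_Ici.1 ht)]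

variable [CompleteSpace H]

/-- Two mild solutions of `u' + A u + F u = 0` approach each other exponentially. -/
lemma IsMildSolution.norm_sub_le_exp (hP : IsCoerciveSemilinear A S F α)
    {u₁ u₂ : ℝ → H} (h₁ : IsMildSolution S (fun t => F (u₁ t)) u₁)
    (h₂ : IsMildSolution S (fun t => F (u₂ t)) u₂) {t : ℝ} (ht : 0 ≤ t) :
    ‖u₁ t - u₂ t‖ ≤ ‖u₁ 0 - u₂ 0‖ * Real.exp (-(α / 2) * t) := by
  refine (h₁.sub hP.semigroup h₂).norm_le_exp_of_inner_le hP.semigroup hP.pos (norm_nonneg _) le_rfl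
    (fun s _ => ?_) ht
  obtain ⟨ξ, hξ⟩ := exists_inner_fderiv_eq hP.differentiable (u₁ s) (u₂ s)
  refine ⟨_, hP.coercive ξ, hξ.le.trans ?_⟩
  have hα := hP.pos
  have : 0 ≤ α / 4 * (‖u₁ 0 - u₂ 0‖ * Real.exp (-(α / 2) * s)) * ‖u₁ s - u₂ s‖ := by
    positivity
  linarith

/-- Global mild solutions of `u' + A u + F u = 0`. The nonlinearity is truncated to a globally
Lipschitz one; coercivity keeps the solution in the ball where the truncation is inactive. -/
theorem IsCoerciveSemilinear.exists_isMildSolution (hP : IsCoerciveSemilinear A S F α) (w : H) :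
    ∃ u : ℝ → H, u 0 = w ∧ IsMildSolution S (fun t => F (u t)) u := by
  set r := ‖w‖ + 1 with hr
  have hr0 : 0 < r := by positivity
  obtain ⟨K, L, h⟩ := hP.lipschitz_fderiv.exists_hasC11BoundsOn (r + 1)
  have hK := h.nonneg_fst
  have hFc := hP.differentiable.continuous
  have hcc : Continuous fun x : H => radialCutoff r x := by
    unfold radialCutoff; fun_prop
  obtain ⟨u, hu0, hu⟩ := hP.semigroup.exists_isMildSolution (ω := ‖fderiv ℝ F 0‖)
    (fun t ht x => hP.semigroup.norm_apply_le hP.pos.le (hP.coercive 0) ht x)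
    (G := fun _ x => radialCutoff r x • F x) (by fun_prop)
    (by positivity : 0 ≤ K + K * (r + 1))
    (fun _ x y => norm_radialCutoff_smul_sub_le hP.map_zero hP.differentiable hr0.le h x y)
    (by simp [hP.map_zero]) w
  have hle : ∀ t, 0 ≤ t → ‖u t‖ ≤ r := by
    intro t ht
    have hexp : ∀ t, 0 ≤ t → r * Real.exp (-(α / 2) * t) ≤ r := fun t ht =>
      mul_exp_neg_le hP.pos hr0.le ht
    refine (hu.norm_le_exp hP.semigroup hP.pos hr0 (by rw [hu0, hr]; linarith)
      (fun s hs => ?_) ht).trans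
      (hexp t ht)
    obtain ⟨ξ, hξ⟩ := exists_inner_fderiv_eq hP.differentiable (u s) 0
    rw [hP.map_zero, sub_zero, sub_zero] at hξ
    refine ⟨_, hP.coercive ξ, fun he => ?_⟩
    rw [radialCutoff_eq_one (he.trans_le (hexp s hs)), one_smul, hξ]
    have hα := hP.pos
    have : 0 ≤ α / 4 * ‖u s‖ ^ 2 := by positivity
    linarith
  refine ⟨u, hu0, hP.differentiable.continuous.comp hu.continuous, hu.continuous, fun t ht => ?_⟩
  rw [hu.eq t ht]
  congr 1
  refine intervalIntegral.integral_congr fun s hs => ?_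
  rw [uIcc_of_le ht] at hs
  simp only [radialCutoff_eq_one (hle s hs.1), one_smul]

theorem IsCoerciveSemilinear.exists_isMildFlow (hP : IsCoerciveSemilinear A S F α) :
    ∃ T : ℝ → H → H, IsMildFlow S F T := by
  choose u hu0 hu using hP.exists_isMildSolution
  refine ⟨fun t w => u w t, hu0, fun w => ?_⟩
  have hc : Continuous fun t : ℝ => u w (max t 0) := (hu w).continuous.comp (by fun_prop)
  refine ⟨hP.differentiable.continuous.comp hc, hc, fun t ht => ?_⟩
  simp only [max_self, max_eq_left ht]
  rw [(hu w).eq t ht]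
  congr 1
  refine intervalIntegral.integral_congr fun s hs => ?_
  rw [uIcc_of_le ht] at hs
  simp only [max_eq_left hs.1]

namespace IsMildFlow

variable {T : ℝ → H → H}

lemma norm_sub_le (hT : IsMildFlow S F T) (hP : IsCoerciveSemilinear A S F α)
    {t : ℝ} (ht : 0 ≤ t) (w₁ w₂ : H) :
    ‖T t w₁ - T t w₂‖ ≤ ‖w₁ - w₂‖ * Real.exp (-(α / 2) * t) := by
  simpa [max_eq_left ht, hT.zero] using
    (hT.mild w₁).norm_sub_le_exp hP (hT.mild w₂) ht

lemma add (hT : IsMildFlow S F T) (hP : IsCoerciveSemilinear A S F α)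
    {s t : ℝ} (hs : 0 ≤ s) (ht : 0 ≤ t) (w : H) : T (s + t) w = T s (T t w) := by
  have := ((hT.mild w).translate hP.semigroup ht).norm_sub_le_exp hP (hT.mild (T t w)) hs
  rw [add_zero, max_eq_left ht, max_self, hT.zero, sub_self, norm_zero, zero_mul,
    max_eq_left (add_nonneg ht hs), max_eq_left hs, add_comm] at this
  exact sub_eq_zero.1 (norm_le_zero_iff.1 this)

lemma map_zero (hT : IsMildFlow S F T) (hP : IsCoerciveSemilinear A S F α) {t : ℝ} (ht : 0 ≤ t) :
    T t 0 = 0 := by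
  have h0 : IsMildSolution S (fun _ => F 0) (fun _ => (0 : H)) :=
    ⟨continuous_const, continuous_const, fun t _ => by simp [hP.map_zero]⟩
  have := (hT.mild 0).norm_sub_le_exp hP h0 ht
  simpa [hT.zero, max_eq_left ht] using this

lemma norm_le (hT : IsMildFlow S F T) (hP : IsCoerciveSemilinear A S F α) {t : ℝ}
    (ht : 0 ≤ t) (w : H) : ‖T t w‖ ≤ ‖w‖ * Real.exp (-(α / 2) * t) := by
  simpa [hT.map_zero hP ht] using hT.norm_sub_le hP ht w 0

end IsMildFlow

end Flow

/-! ### Differentiability of the nonlinear semigroup -/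

section Linearization

variable {H : Type*} [NormedAddCommGroup H] [InnerProductSpace ℝ H]
  {A : H →ₗ.[ℝ] H} {S : ℝ → H →L[ℝ] H} {F : H → H} {α : ℝ} {T : ℝ → H → H}

namespace IsMildFlow

lemma continuous_fderiv_orbit (hT : IsMildFlow S F T) (hP : IsCoerciveSemilinear A S F α)
    (w : H) : Continuous fun t : ℝ => fderiv ℝ F (T (max t 0) w) :=
  (hP.contDiff.continuous_fderiv one_ne_zero).comp (hT.mild w).continuous

lemma fderiv_zero_apply (hT : IsMildFlow S F T) (w h : H) : fderiv ℝ (T 0) w h = h := by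
  have : T 0 = id := funext hT.zero
  simp [this]

variable [CompleteSpace H]

lemma mem_closedBall (hT : IsMildFlow S F T) (hP : IsCoerciveSemilinear A S F α) {r : ℝ}
    {t : ℝ} (ht : 0 ≤ t) {w : H} (hw : w ∈ Metric.closedBall (0 : H) r) :
    T t w ∈ Metric.closedBall (0 : H) r := by
  rw [mem_closedBall_zero_iff] at hw ⊢
  exact ((hT.norm_le hP ht w).trans (mul_exp_neg_le hP.pos (norm_nonneg w) ht)).trans hw

lemma exists_linearized (hT : IsMildFlow S F T) (hP : IsCoerciveSemilinear A S F α) (w h : H) :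
    ∃ y : ℝ → H, y 0 = h ∧ IsMildSolution S (fun t => fderiv ℝ F (T (max t 0) w) (y t)) y := by
  obtain ⟨K, L, hKL⟩ := hP.lipschitz_fderiv.exists_hasC11BoundsOn ‖w‖
  have hc := hT.continuous_fderiv_orbit hP w
  refine hP.semigroup.exists_isMildSolution (ω := ‖fderiv ℝ F 0‖)
    (fun t ht x => hP.semigroup.norm_apply_le hP.pos.le (hP.coercive 0) ht x)
    (G := fun t x => fderiv ℝ F (T (max t 0) w) x)
    ((hc.comp continuous_fst).clm_apply continuous_snd) hKL.nonneg_fst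
    (fun t x y => ?_) (by simp) h
  rw [← map_sub]
  refine ContinuousLinearMap.le_of_opNorm_le _ (hKL.norm_fderiv_le _ ?_) _
  exact hT.mem_closedBall hP (le_max_right t 0) (by simp)

lemma norm_linearized_le (hP : IsCoerciveSemilinear A S F α) {v y : ℝ → H}
    (hy : IsMildSolution S (fun t => fderiv ℝ F (v t) (y t)) y) {t : ℝ} (ht : 0 ≤ t) :
    ‖y t‖ ≤ ‖y 0‖ * Real.exp (-(α / 2) * t) := by
  refine hy.norm_le_exp_of_inner_le hP.semigroup hP.pos (norm_nonneg _) le_rfl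
    (fun s _ => ⟨_, hP.coercive (v s), ?_⟩) ht
  have hα := hP.pos
  have : 0 ≤ α / 4 * (‖y 0‖ * Real.exp (-(α / 2) * s)) * ‖y s‖ := by positivity
  linarith

lemma linearized_unique (hP : IsCoerciveSemilinear A S F α) {v y₁ y₂ : ℝ → H}
    (h₁ : IsMildSolution S (fun t => fderiv ℝ F (v t) (y₁ t)) y₁)
    (h₂ : IsMildSolution S (fun t => fderiv ℝ F (v t) (y₂ t)) y₂) (h0 : y₁ 0 = y₂ 0)
    {t : ℝ} (ht : 0 ≤ t) : y₁ t = y₂ t := by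
  have h := h₁.sub hP.semigroup h₂
  simp only [← map_sub] at h
  have := norm_linearized_le hP h ht
  simpa [h0, sub_eq_zero] using this

/-- The remainder of the linearization of the flow is quadratic, and decays exponentially. -/
lemma norm_sub_sub_linearized_le (hT : IsMildFlow S F T) (hP : IsCoerciveSemilinear A S F α)
    {s : Set H} {K L : ℝ} (hs : HasC11BoundsOn F s K L)
    (hinv : ∀ t, 0 ≤ t → ∀ w ∈ s, T t w ∈ s) {w w' : H} (hw : w ∈ s) (hw' : w' ∈ s)
    {y : ℝ → H} (hy0 : y 0 = w' - w)
    (hy : IsMildSolution S (fun t => fderiv ℝ F (T (max t 0) w) (y t)) y)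
    {t : ℝ} (ht : 0 ≤ t) :
    ‖T t w' - T t w - y t‖ ≤ 4 * L / α * ‖w' - w‖ ^ 2 * Real.exp (-(α / 2) * t) := by
  have hα := hP.pos
  have hL := hs.nonneg_snd
  -- with this `κ` the barrier error `(α/4) κ` is exactly the Taylor constant `L ‖w' - w‖²`
  have key := (((hT.mild w').sub hP.semigroup (hT.mild w)).sub hP.semigroup
    hy).norm_le_exp_of_inner_le hP.semigroup hP.pos (κ := 4 * L / α * ‖w' - w‖ ^ 2)
    (by positivity) ?_ (fun τ hτ => ⟨_, hP.coercive (T τ w), ?_⟩) ht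
  · simpa only [max_eq_left ht] using key
  · simp only [max_self, hT.zero, hy0, sub_self, norm_zero]
    positivity
  · simp only [max_eq_left hτ]
    set q := T τ w' - T τ w - y τ with hq
    have h1 : ‖F (T τ w') - F (T τ w) - fderiv ℝ F (T τ w) (T τ w' - T τ w)‖ ≤
        L * (‖w' - w‖ ^ 2 * Real.exp (-(α / 2) * τ)) := by
      refine (hs.norm_taylor_le hP.differentiable (hinv τ hτ _ hw') (hinv τ hτ _ hw)).trans ?_
      gcongr
      have h2 := hT.norm_sub_le hP hτ w' w
      have h3 := h2.trans (mul_exp_neg_le hP.pos (norm_nonneg _) hτ)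
      calc _ = ‖T τ w' - T τ w‖ * ‖T τ w' - T τ w‖ := sq _
        _ ≤ ‖w' - w‖ * (‖w' - w‖ * Real.exp (-(α / 2) * τ)) := by gcongr
        _ = _ := by ring
    have h4 : fderiv ℝ F (T τ w) q = (F (T τ w') - F (T τ w) - fderiv ℝ F (T τ w) (y τ)) -
        (F (T τ w') - F (T τ w) - fderiv ℝ F (T τ w) (T τ w' - T τ w)) := by
      rw [hq, map_sub]; abel
    rw [h4, inner_sub_left, sub_eq_add_neg, ← inner_neg_left]
    gcongr
    refine (real_inner_le_norm _ _).trans ?_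
    rw [norm_neg]
    gcongr
    refine h1.trans_eq ?_
    field_simp

lemma exists_fderiv (hT : IsMildFlow S F T) (hP : IsCoerciveSemilinear A S F α) (w : H) :
    ∃ D : ℝ → H →L[ℝ] H, (∀ h, IsMildSolution S
      (fun t => fderiv ℝ F (T (max t 0) w) (D t h)) (fun t => D t h)) ∧
      (∀ t, D t = D (max t 0)) ∧ ∀ t, 0 ≤ t → HasFDerivAt (T t) (D t) w := by
  choose y hy0 hy using hT.exists_linearized hP w
  have hadd : ∀ h k t, 0 ≤ t → y (h + k) t = y h t + y k t := by
    intro h k t ht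
    have h1 := (hy h).add hP.semigroup (hy k)
    simp only [← map_add] at h1
    exact linearized_unique hP (hy _) h1 (by simp [hy0]) ht
  have hsmul : ∀ (c : ℝ) h t, 0 ≤ t → y (c • h) t = c • y h t := by
    intro c h t ht
    have h1 := (hy h).const_smul c
    simp only [← map_smul] at h1
    exact linearized_unique hP (hy _) h1 (by simp [hy0]) ht
  have hbound : ∀ h t, 0 ≤ t → ‖y h t‖ ≤ 1 * ‖h‖ := by
    intro h t ht
    have := (norm_linearized_le hP (hy h) ht).trans (mul_exp_neg_le hP.pos (norm_nonneg _) ht)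
    rwa [hy0, ← one_mul ‖h‖] at this
  let D : ℝ → H →L[ℝ] H := fun t => LinearMap.mkContinuous
    { toFun := fun h => y h (max t 0)
      map_add' := fun h k => hadd h k _ (le_max_right t 0)
      map_smul' := fun c h => hsmul c h _ (le_max_right t 0) } 1
    fun h => hbound h _ (le_max_right t 0)
  have hD : ∀ t h, D t h = y h (max t 0) := fun t h => rfl
  refine ⟨D, fun h => ⟨?_, ?_, fun t ht => ?_⟩, fun t => ?_, fun t ht => ?_⟩
  · have h1 := hT.continuous_fderiv_orbit hP w
    have h2 := (hy h).continuous
    simp only [hD]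
    fun_prop
  · have h2 := (hy h).continuous
    simp only [hD]
    fun_prop
  · simp only [hD, max_self, max_eq_left ht]
    rw [(hy h).eq t ht]
    congr 1
    refine intervalIntegral.integral_congr fun s hs => ?_
    rw [uIcc_of_le ht] at hs
    simp only [max_eq_left hs.1]
  · ext h
    simp [hD]
  · obtain ⟨K, L, hKL⟩ := hP.lipschitz_fderiv.exists_hasC11BoundsOn (‖w‖ + 1)
    have hα := hP.pos
    have hL := hKL.nonneg_snd
    refine HasFDerivAt.of_isLittleO ?_
    have hO : (fun w' => T t w' - T t w - D t (w' - w)) =O[𝓝 w] fun w' => ‖w' - w‖ ^ 2 := by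
      refine Asymptotics.IsBigO.of_bound (4 * L / α) ?_
      filter_upwards [Metric.ball_mem_nhds w one_pos] with w' hw'
      rw [mem_ball_iff_norm] at hw'
      have h1 := hT.norm_sub_sub_linearized_le hP hKL
        (fun t ht w hw => hT.mem_closedBall hP ht hw) (w := w) (w' := w') (by simp)
        (by rw [mem_closedBall_zero_iff]; linarith [norm_le_norm_add_norm_sub' w' w])
        (hy0 _) (hy (w' - w)) ht
      rw [hD, max_eq_left ht, Real.norm_eq_abs, abs_of_nonneg (by positivity)]
      exact h1.trans (mul_exp_neg_le hP.pos (by positivity) ht)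
    refine hO.trans_isLittleO ?_
    have := (Asymptotics.isLittleO_norm_pow_id (E' := H) one_lt_two).comp_tendsto
      (tendsto_sub_nhds_zero_iff.2 (tendsto_id (x := 𝓝 w)))
    exact this

lemma differentiable (hT : IsMildFlow S F T) (hP : IsCoerciveSemilinear A S F α) {t : ℝ}
    (ht : 0 ≤ t) : Differentiable ℝ (T t) := fun w => by
  obtain ⟨D, -, -, hD⟩ := hT.exists_fderiv hP w
  exact (hD t ht).differentiableAt

/-- The differential of the flow solves the linearized equation. -/
lemma mild_fderiv (hT : IsMildFlow S F T) (hP : IsCoerciveSemilinear A S F α) (w h : H) :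
    IsMildSolution S (fun t => fderiv ℝ F (T (max t 0) w) (fderiv ℝ (T (max t 0)) w h))
      (fun t => fderiv ℝ (T (max t 0)) w h) := by
  obtain ⟨D, hD1, hD2, hD3⟩ := hT.exists_fderiv hP w
  have : ∀ t, fderiv ℝ (T (max t 0)) w = D t := fun t => by
    rw [hD2, (hD3 _ (le_max_right t 0)).fderiv]
  simp only [this]
  exact hD1 h

lemma norm_fderiv_apply_le (hT : IsMildFlow S F T) (hP : IsCoerciveSemilinear A S F α) {t : ℝ}
    (ht : 0 ≤ t) (w h : H) : ‖fderiv ℝ (T t) w h‖ ≤ ‖h‖ * Real.exp (-(α / 2) * t) := by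
  simpa only [max_eq_left ht, max_self, hT.fderiv_zero_apply] using
    norm_linearized_le hP (hT.mild_fderiv hP w h) ht

lemma norm_taylor_le (hT : IsMildFlow S F T) (hP : IsCoerciveSemilinear A S F α)
    {s : Set H} {K L : ℝ} (hs : HasC11BoundsOn F s K L)
    (hinv : ∀ t, 0 ≤ t → ∀ w ∈ s, T t w ∈ s) {w w' : H} (hw : w ∈ s) (hw' : w' ∈ s)
    {t : ℝ} (ht : 0 ≤ t) :
    ‖T t w' - T t w - fderiv ℝ (T t) w (w' - w)‖ ≤
      4 * L / α * ‖w' - w‖ ^ 2 * Real.exp (-(α / 2) * t) := by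
  simpa only [max_eq_left ht] using hT.norm_sub_sub_linearized_le hP hs hinv hw hw'
    (by rw [max_self, hT.fderiv_zero_apply]) (hT.mild_fderiv hP w (w' - w)) ht

lemma norm_fderiv_sub_le (hT : IsMildFlow S F T) (hP : IsCoerciveSemilinear A S F α)
    {s : Set H} {K L : ℝ} (hs : HasC11BoundsOn F s K L)
    (hinv : ∀ t, 0 ≤ t → ∀ w ∈ s, T t w ∈ s) {w w' : H} (hw : w ∈ s) (hw' : w' ∈ s) (h : H)
    {t : ℝ} (ht : 0 ≤ t) :
    ‖fderiv ℝ (T t) w' h - fderiv ℝ (T t) w h‖ ≤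
      4 * L / α * ‖w' - w‖ * ‖h‖ * Real.exp (-(α / 2) * t) := by
  have hα := hP.pos
  have hL := hs.nonneg_snd
  have key := ((hT.mild_fderiv hP w' h).sub hP.semigroup
    (hT.mild_fderiv hP w h)).norm_le_exp_of_inner_le hP.semigroup hP.pos
    (κ := 4 * L / α * ‖w' - w‖ * ‖h‖) (by positivity) ?_
    (fun τ hτ => ⟨_, hP.coercive (T τ w'), ?_⟩) ht
  · simpa only [max_eq_left ht] using key
  · simp only [max_self, hT.fderiv_zero_apply, sub_self, norm_zero]
    positivity
  · simp only [max_eq_left hτ]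
    set y' := fderiv ℝ (T τ) w' h
    set y := fderiv ℝ (T τ) w h
    have h1 : ‖(fderiv ℝ F (T τ w') - fderiv ℝ F (T τ w)) y‖ ≤
        L * ‖w' - w‖ * (‖h‖ * Real.exp (-(α / 2) * τ)) := by
      refine ContinuousLinearMap.le_of_opNorm_le_of_le _ ?_ (hT.norm_fderiv_apply_le hP hτ w h)
      refine (hs.norm_fderiv_sub_le _ (hinv τ hτ _ hw') _ (hinv τ hτ _ hw)).trans ?_
      gcongr
      exact (hT.norm_sub_le hP hτ w' w).trans (mul_exp_neg_le hP.pos (norm_nonneg _) hτ)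
    have h4 : fderiv ℝ F (T τ w') (y' - y) = (fderiv ℝ F (T τ w') y' - fderiv ℝ F (T τ w) y) -
        (fderiv ℝ F (T τ w') - fderiv ℝ F (T τ w)) y := by
      rw [map_sub, _root_.sub_apply]; abel
    rw [h4, inner_sub_left, sub_eq_add_neg, ← inner_neg_left]
    gcongr
    refine (real_inner_le_norm _ _).trans ?_
    rw [norm_neg]
    gcongr
    refine h1.trans_eq ?_
    field_simp

end IsMildFlow

end Linearization

/-! ### Orbits starting in the domain, and uniqueness of the generated semigroup -/

lemma AbsolutelyContinuousOnInterval.norm {E : Type*} [NormedAddCommGroup E] {f : ℝ → E}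
    {a b : ℝ} (hf : AbsolutelyContinuousOnInterval f a b) :
    AbsolutelyContinuousOnInterval (fun t => ‖f t‖) a b := by
  refine squeeze_zero (fun t => Finset.sum_nonneg fun i _ => dist_nonneg) (fun t => ?_) hf
  refine Finset.sum_le_sum fun i _ => ?_
  rw [Real.dist_eq, dist_eq_norm]
  exact abs_norm_sub_norm_le _ _

section Regularity

variable {H : Type*} [NormedAddCommGroup H] [InnerProductSpace ℝ H]
  {A : H →ₗ.[ℝ] H} {S : ℝ → H →L[ℝ] H} {F : H → H} {α : ℝ} {T : ℝ → H → H}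

lemma IsCoerciveSemilinear.inner_semilinearOp_sub_nonneg (hP : IsCoerciveSemilinear A S F α)
    (x y : (A.domain : Set H)) :
    0 ≤ inner ℝ ((x : H) - y) (semilinearOp A F x - semilinearOp A F y) := by
  obtain ⟨ξ, hξ⟩ := exists_inner_fderiv_eq hP.differentiable (x : H) y
  have h1 := hP.coercive ξ (⟨x, x.2⟩ - ⟨y, y.2⟩ : A.domain)
  have h2 : semilinearOp A F x - semilinearOp A F y =
      A (⟨x, x.2⟩ - ⟨y, y.2⟩ : A.domain) + (F x - F y) := by
    rw [A.map_sub]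
    simp only [semilinearOp]
    abel
  rw [h2, real_inner_comm, inner_add_left, ← hξ, ← inner_add_left]
  have hα := hP.pos
  exact le_trans (by positivity) h1

/-- Strong solutions are determined by their initial value: the squared distance of two of them is
absolutely continuous with nonpositive derivative. -/
lemma IsStrongSolution.eq_of_eq_zero (hP : IsCoerciveSemilinear A S F α) {τ : ℝ} (hτ : 0 < τ)
    {u v : ℝ → H} (hu : IsStrongSolution (semilinearOp A F) τ u)
    (hv : IsStrongSolution (semilinearOp A F) τ v) (h0 : u 0 = v 0) : u τ = v τ := by
  have hac := (hu.absolutelyContinuous.fun_sub hv.absolutelyContinuous).norm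
  have hac2 := hac.fun_mul hac
  have h1 := hac2.integral_deriv_eq_sub
  have h2 : ∫ t in (0 : ℝ)..τ, deriv (fun t => ‖u t - v t‖ * ‖u t - v t‖) t ≤ 0 := by
    rw [intervalIntegral.integral_of_le hτ.le, integral_Ioc_eq_integral_Ioo]
    refine integral_nonpos_of_ae ?_
    filter_upwards [hu.equation, hv.equation] with t ⟨hut, hu'⟩ ⟨hvt, hv'⟩
    have h3 := (hu'.sub hv').norm_sq
    simp only [Pi.sub_apply, sq] at h3
    rw [h3.deriv]
    have h4 := hP.inner_semilinearOp_sub_nonneg ⟨u t, hut⟩ ⟨v t, hvt⟩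
    rw [← neg_sub', inner_neg_right]
    simp only [Pi.zero_apply]
    linarith
  rw [h1, h0, sub_self, norm_zero, zero_mul, sub_zero] at h2
  have h3 : ‖u τ - v τ‖ = 0 := mul_self_eq_zero.1 (le_antisymm h2 (mul_self_nonneg _))
  exact sub_eq_zero.1 (norm_eq_zero.1 h3)

namespace IsMildFlow

/-- The velocity at time `t` of the orbit of `w`. It is the linearized flow applied to the initial
velocity. -/
noncomputable def velocity (A : H →ₗ.[ℝ] H) (F : H → H) (T : ℝ → H → H) (w : A.domain) (t : ℝ) :
    H :=
  fderiv ℝ (T (max t 0)) w (-(A w + F w))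

lemma apply_eq (hT : IsMildFlow S F T) (w : H) {t : ℝ} (ht : 0 ≤ t) :
    T t w = S t w - ∫ s in (0 : ℝ)..t, extendPos S (t - s) (F (T (max s 0) w)) := by
  simpa [max_eq_left ht, hT.zero] using (hT.mild w).eq t ht

variable [CompleteSpace H]

lemma hasDerivAt_convolution (hT : IsMildFlow S F T) (hP : IsCoerciveSemilinear A S F α) (w : H) :
    HasDerivAt (fun t => ∫ s in (0 : ℝ)..t, extendPos S (t - s) (F (T (max s 0) w))) (F w) 0 := by
  simpa [hT.zero] using
    hP.semigroup.hasDerivAt_convolution_zero (hT.mild w).continuous_source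

lemma hasDerivWithinAt_zero (hT : IsMildFlow S F T) (hP : IsCoerciveSemilinear A S F α)
    (w : A.domain) : HasDerivWithinAt (fun t => T t (w : H)) (-(A w + F w)) (Ici 0) 0 := by
  have h1 := ((hP.semigroup.generator w (A w)).1 ⟨w.2, rfl⟩).sub
    (hT.hasDerivAt_convolution hP (w : H)).hasDerivWithinAt
  rw [neg_add']
  exact h1.congr (fun t ht => hT.apply_eq _ ht) (hT.apply_eq _ le_rfl)

lemma continuous_velocity (hT : IsMildFlow S F T) (hP : IsCoerciveSemilinear A S F α)
    (w : A.domain) : Continuous (velocity A F T w) :=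
  (hT.mild_fderiv hP w _).continuous

lemma norm_velocity_le (hT : IsMildFlow S F T) (hP : IsCoerciveSemilinear A S F α)
    (w : A.domain) (t : ℝ) : ‖velocity A F T w t‖ ≤ ‖A w + F w‖ := by
  have := (hT.norm_fderiv_apply_le hP (le_max_right t 0) w (-(A w + F w))).trans
    (mul_exp_neg_le hP.pos (norm_nonneg _) (le_max_right t 0))
  rwa [norm_neg] at this

/-- The semigroup property `T (t + ε) w = T t (T ε w)` and the chain rule give the right derivative
of an orbit without knowing that the orbit stays in the domain. -/
lemma hasDerivWithinAt_apply_add (hT : IsMildFlow S F T) (hP : IsCoerciveSemilinear A S F α)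
    (w : A.domain) {t : ℝ} (ht : 0 ≤ t) :
    HasDerivWithinAt (fun ε => T (t + ε) (w : H)) (velocity A F T w t) (Ici 0) 0 := by
  have h1 := hT.hasDerivWithinAt_zero hP w
  have h2 : HasFDerivAt (T t) (fderiv ℝ (T t) w) (T 0 w) := by
    rw [hT.zero]
    exact (hT.differentiable hP ht _).hasFDerivAt
  have h3 := h2.comp_hasDerivWithinAt (0 : ℝ) h1
  rw [velocity, max_eq_left ht]
  exact h3.congr (fun ε hε => hT.add hP ht hε _) (hT.add hP ht le_rfl _)

lemma apply_eq_add_integral_velocity (hT : IsMildFlow S F T) (hP : IsCoerciveSemilinear A S F α)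
    (w : A.domain) {t : ℝ} (ht : 0 ≤ t) :
    T t (w : H) = w + ∫ s in (0 : ℝ)..t, velocity A F T w s := by
  have hI : ∀ s, HasDerivAt (fun t => ∫ s in (0 : ℝ)..t, velocity A F T w s)
      (velocity A F T w s) s := fun s =>
    ((hT.continuous_velocity hP w).integral_hasStrictDerivAt 0 s).hasDerivAt
  have key := constant_of_has_deriv_right_zero
    (f := fun t => T t (w : H) - ∫ s in (0 : ℝ)..t, velocity A F T w s) (a := 0) (b := t)
    (((hT.continuousOn (w : H)).mono Icc_subset_Ici_self).sub
      fun s _ => (hI s).continuousAt.continuousWithinAt) (fun s hs => ?_) t ⟨ht, le_rfl⟩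
  · simp only [intervalIntegral.integral_same, sub_zero, hT.zero] at key
    exact sub_eq_iff_eq_add.1 key
  · have h0 := hT.hasDerivWithinAt_apply_add hP w hs.1
    rw [← sub_self s] at h0
    have h1 := h0.scomp (h := fun r => r - s) s
      ((hasDerivAt_id s).sub_const s).hasDerivWithinAt (s := Ici s)
      (fun r hr => by simpa using hr)
    have h2 := h1.sub (hI s).hasDerivWithinAt
    rw [one_smul, sub_self] at h2
    exact h2.congr (fun r _ => by simp) (by simp)

lemma hasDerivAt_apply (hT : IsMildFlow S F T) (hP : IsCoerciveSemilinear A S F α)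
    (w : A.domain) {t : ℝ} (ht : 0 < t) :
    HasDerivAt (fun s => T s (w : H)) (velocity A F T w t) t := by
  have hI := (((hT.continuous_velocity hP w).integral_hasStrictDerivAt 0 t).hasDerivAt).const_add
    (w : H)
  refine hI.congr_of_eventuallyEq ?_
  filter_upwards [lt_mem_nhds ht] with s hs
  exact hT.apply_eq_add_integral_velocity hP w hs.le

lemma apply_mem_domain (hT : IsMildFlow S F T) (hP : IsCoerciveSemilinear A S F α)
    (w : A.domain) {t : ℝ} (ht : 0 ≤ t) :
    ∃ h : T t w ∈ A.domain, A ⟨T t w, h⟩ = -velocity A F T w t - F (T t w) := by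
  rw [hP.semigroup.generator]
  have h1 := (hT.hasDerivWithinAt_apply_add hP w ht).add
    (hT.hasDerivAt_convolution hP (T t w)).hasDerivWithinAt
  rw [neg_sub, sub_neg_eq_add, add_comm]
  have hadd : ∀ ε, 0 ≤ ε → S ε (T t w) = T (t + ε) w +
      ∫ s in (0 : ℝ)..ε, extendPos S (ε - s) (F (T (max s 0) (T t w))) := fun ε hε => by
    rw [add_comm t, hT.add hP hε ht, hT.apply_eq (T t w) hε, sub_add_cancel]
  exact h1.congr (fun ε hε => hadd ε hε) (hadd 0 le_rfl)

lemma isStrongSolution (hT : IsMildFlow S F T) (hP : IsCoerciveSemilinear A S F α)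
    {w : H} (hw : w ∈ A.domain) {τ : ℝ} (hτ : 0 < τ) :
    IsStrongSolution (semilinearOp A F) τ (fun t => T t w) where
  absolutelyContinuous := by
    refine LipschitzOnWith.absolutelyContinuousOnInterval (K := ‖A ⟨w, hw⟩ + F w‖₊) ?_
    rw [uIcc_of_le hτ.le]
    refine LipschitzOnWith.of_dist_le_mul fun s hs t ht => ?_
    have hi := fun a b => (hT.continuous_velocity hP ⟨w, hw⟩).intervalIntegrable (μ := volume) a b
    rw [hT.apply_eq_add_integral_velocity hP ⟨w, hw⟩ hs.1,
      hT.apply_eq_add_integral_velocity hP ⟨w, hw⟩ ht.1, dist_add_left, dist_eq_norm,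
      intervalIntegral.integral_interval_sub_left (hi _ _) (hi _ _), Real.dist_eq]
    exact intervalIntegral.norm_integral_le_of_norm_le_const
      fun r _ => hT.norm_velocity_le hP ⟨w, hw⟩ r
  mem_domain t ht := (hT.apply_mem_domain hP ⟨w, hw⟩ ht.1.le).1
  equation := by
    refine (ae_restrict_iff' measurableSet_Ioo).2 (ae_of_all _ fun t ht => ?_)
    obtain ⟨h1, h2⟩ := hT.apply_mem_domain hP ⟨w, hw⟩ ht.1.le
    refine ⟨h1, ?_⟩
    have : -semilinearOp A F ⟨T t w, h1⟩ = velocity A F T ⟨w, hw⟩ t := by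
      simp only [semilinearOp]
      rw [h2]
      abel
    rw [this]
    exact hT.hasDerivAt_apply hP ⟨w, hw⟩ ht.1

theorem isContractionSemigroup (hT : IsMildFlow S F T) (hP : IsCoerciveSemilinear A S F α) :
    IsContractionSemigroupGeneratedByNeg (semilinearOp A F) T where
  zero := hT.zero
  add _ _ hs ht w := hT.add hP hs ht w
  contraction _ ht w₁ w₂ :=
    (hT.norm_sub_le hP ht w₁ w₂).trans (mul_exp_neg_le hP.pos (norm_nonneg _) ht)
  continuousOn w := hT.continuousOn w
  strong _ hw _ hτ := hT.isStrongSolution hP hw hτ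

end IsMildFlow

variable [CompleteSpace H]

theorem IsContractionSemigroupGeneratedByNeg.isMildFlow
    {T : ℝ → H → H} (h : IsContractionSemigroupGeneratedByNeg (semilinearOp A F) T)
    (hP : IsCoerciveSemilinear A S F α) : IsMildFlow S F T := by
  obtain ⟨T₀, hT₀⟩ := hP.exists_isMildFlow
  have h₀ := hT₀.isContractionSemigroup hP
  have hcont : ∀ {T : ℝ → H → H}, IsContractionSemigroupGeneratedByNeg (semilinearOp A F) T →
      ∀ t, 0 ≤ t → Continuous (T t) := fun h t ht =>
    (LipschitzWith.of_dist_le_mul (K := 1) fun x y => by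
      simpa [dist_eq_norm] using h.contraction t ht x y).continuous
  have key : ∀ t, 0 ≤ t → T t = T₀ t := by
    intro t ht
    rcases ht.eq_or_lt with rfl | ht'
    · funext w; rw [h.zero, h₀.zero]
    refine Continuous.ext_on hP.semigroup.dense_domain (hcont h t ht) (hcont h₀ t ht)
      fun w hw => ?_
    exact (h.strong w hw t ht').eq_of_eq_zero hP ht' (h₀.strong w hw t ht')
      (by rw [h.zero, h₀.zero])
  refine ⟨h.zero, fun w => ?_⟩
  simp only [fun t : ℝ => key (max t 0) (le_max_right t 0)]
  exact hT₀.mild w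

end Regularity

/-! ### The time integral of the nonlinearity along orbits -/

lemma integrableOn_Ioi_of_norm_le_exp {E : Type*} [NormedAddCommGroup E] {α : ℝ} (hα : 0 < α)
    {f : ℝ → E} (hf : Continuous fun t => f (max t 0)) {c : ℝ}
    (hc : ∀ t, 0 ≤ t → ‖f t‖ ≤ c * Real.exp (-(α / 2) * t)) : IntegrableOn f (Ioi 0) := by
  refine Integrable.mono' ((exp_neg_integrableOn_Ioi 0 (half_pos hα)).const_mul c)
    (ContinuousOn.aestronglyMeasurable
      (hf.continuousOn.congr fun t ht => by simp only [max_eq_left (le_of_lt (mem_Ioi.1 ht))])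
      measurableSet_Ioi)
    ((ae_restrict_iff' measurableSet_Ioi).2 (ae_of_all _ fun t ht => hc t (le_of_lt ht)))

lemma norm_integral_Ioi_le_of_norm_le_exp {E : Type*} [NormedAddCommGroup E] [NormedSpace ℝ E]
    {α : ℝ} (hα : 0 < α) {f : ℝ → E} {c : ℝ}
    (hc : ∀ t, 0 ≤ t → ‖f t‖ ≤ c * Real.exp (-(α / 2) * t)) :
    ‖∫ t in Ioi (0 : ℝ), f t‖ ≤ c * (2 / α) := by
  refine (norm_integral_le_of_norm_le ((exp_neg_integrableOn_Ioi 0 (half_pos hα)).const_mul c)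
    ((ae_restrict_iff' measurableSet_Ioi).2
      (ae_of_all _ fun t ht => hc t (le_of_lt ht)))).trans_eq ?_
  rw [integral_const_mul, integral_exp_mul_Ioi (by linarith)]
  congr 1
  simp

section TimeIntegral

variable {H : Type*} [NormedAddCommGroup H] [InnerProductSpace ℝ H] [CompleteSpace H]
  {A : H →ₗ.[ℝ] H} {S : ℝ → H →L[ℝ] H} {F : H → H} {α : ℝ} {T : ℝ → H → H}

namespace IsMildFlow

lemma norm_comp_le (hT : IsMildFlow S F T) (hP : IsCoerciveSemilinear A S F α) (w : H) :
    ∃ c, ∀ t, 0 ≤ t → ‖F (T t w)‖ ≤ c * Real.exp (-(α / 2) * t) := by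
  obtain ⟨K, L, h⟩ := hP.lipschitz_fderiv.exists_hasC11BoundsOn ‖w‖
  have hK := h.nonneg_fst
  refine ⟨K * ‖w‖, fun t ht => ?_⟩
  have h1 := h.norm_sub_le hP.differentiable (hT.mem_closedBall hP ht (w := w) (by simp))
    (y := 0) (by simp)
  rw [hP.map_zero, sub_zero, sub_zero] at h1
  rw [mul_assoc]
  exact h1.trans (by gcongr; exact hT.norm_le hP ht w)

lemma norm_fderiv_comp_le (hT : IsMildFlow S F T) (hP : IsCoerciveSemilinear A S F α)
    {s : Set H} {K L : ℝ} (hs : HasC11BoundsOn F s K L)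
    (hinv : ∀ t, 0 ≤ t → ∀ w ∈ s, T t w ∈ s) {w : H} (hw : w ∈ s) (h : H) {t : ℝ}
    (ht : 0 ≤ t) :
    ‖fderiv ℝ F (T t w) (fderiv ℝ (T t) w h)‖ ≤ K * ‖h‖ * Real.exp (-(α / 2) * t) := by
  rw [mul_assoc]
  exact ContinuousLinearMap.le_of_opNorm_le_of_le _ (hs.norm_fderiv_le _ (hinv t ht _ hw))
    (hT.norm_fderiv_apply_le hP ht w h)

lemma integrableOn_comp (hT : IsMildFlow S F T) (hP : IsCoerciveSemilinear A S F α) (w : H) :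
    IntegrableOn (fun t => F (T t w)) (Ioi 0) := by
  obtain ⟨c, hc⟩ := hT.norm_comp_le hP w
  exact integrableOn_Ioi_of_norm_le_exp hP.pos (hT.mild w).continuous_source hc

lemma integrableOn_fderiv_comp (hT : IsMildFlow S F T) (hP : IsCoerciveSemilinear A S F α)
    (w h : H) :
    IntegrableOn (fun t => fderiv ℝ F (T t w) (fderiv ℝ (T t) w h)) (Ioi 0) := by
  obtain ⟨K, L, hKL⟩ := hP.lipschitz_fderiv.exists_hasC11BoundsOn ‖w‖
  exact integrableOn_Ioi_of_norm_le_exp hP.pos (hT.mild_fderiv hP w h).continuous_source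
    fun t ht => hT.norm_fderiv_comp_le hP hKL (fun t ht w hw => hT.mem_closedBall hP ht hw)
      (by simp) h ht

/-- The time integral of `F` along orbits is differentiable, with the differential obtained by
differentiating under the integral. Since `t ↦ fderiv ℝ (T t) w` is only strongly continuous, the
integral of operators is taken pointwise; quadratic remainder estimates replace dominated
convergence. -/
lemma hasFDerivAt_integral (hT : IsMildFlow S F T) (hP : IsCoerciveSemilinear A S F α) (w : H) :
    ∃ Q : H →L[ℝ] H,
      (∀ h, Q h = ∫ t in Ioi (0 : ℝ), fderiv ℝ F (T t w) (fderiv ℝ (T t) w h)) ∧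
      HasFDerivAt (fun w => ∫ t in Ioi (0 : ℝ), F (T t w)) Q w := by
  obtain ⟨K, L, hKL⟩ := hP.lipschitz_fderiv.exists_hasC11BoundsOn (‖w‖ + 1)
  have hα := hP.pos
  have hK := hKL.nonneg_fst
  have hL := hKL.nonneg_snd
  have hinv : ∀ t, 0 ≤ t → ∀ v ∈ Metric.closedBall (0 : H) (‖w‖ + 1),
      T t v ∈ Metric.closedBall (0 : H) (‖w‖ + 1) := fun t ht v hv => hT.mem_closedBall hP ht hv
  have hi := hT.integrableOn_fderiv_comp hP w
  have hsub : ∀ w', IntegrableOn (fun t => F (T t w') - F (T t w)) (Ioi 0) := fun w' =>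
    (hT.integrableOn_comp hP w').sub (hT.integrableOn_comp hP w)
  let Q : H →L[ℝ] H := LinearMap.mkContinuous
    { toFun := fun h => ∫ t in Ioi (0 : ℝ), fderiv ℝ F (T t w) (fderiv ℝ (T t) w h)
      map_add' := fun h k => by
        simp only [map_add]
        exact integral_add (hi h) (hi k)
      map_smul' := fun c h => by
        simp only [map_smul, RingHom.id_apply]
        exact integral_smul c _ } (K * (2 / α)) fun h =>
    (norm_integral_Ioi_le_of_norm_le_exp hP.pos fun t ht =>
      hT.norm_fderiv_comp_le hP hKL hinv (by simp) h ht).trans_eq (by ring)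
  refine ⟨Q, fun h => rfl, HasFDerivAt.of_isLittleO ?_⟩
  have hO : (fun w' => (∫ t in Ioi (0 : ℝ), F (T t w')) - (∫ t in Ioi (0 : ℝ), F (T t w))
      - Q (w' - w)) =O[𝓝 w] fun w' => ‖w' - w‖ ^ 2 := by
    refine Asymptotics.IsBigO.of_bound ((L + K * (4 * L / α)) * (2 / α)) ?_
    filter_upwards [Metric.ball_mem_nhds w one_pos] with w' hw'
    rw [mem_ball_iff_norm] at hw'
    have hw1 : w ∈ Metric.closedBall (0 : H) (‖w‖ + 1) := by simp
    have hw2 : w' ∈ Metric.closedBall (0 : H) (‖w‖ + 1) := by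
      rw [mem_closedBall_zero_iff]; linarith [norm_le_norm_add_norm_sub' w' w]
    rw [← integral_sub (hT.integrableOn_comp hP w') (hT.integrableOn_comp hP w),
      show Q (w' - w) = ∫ t in Ioi (0 : ℝ), fderiv ℝ F (T t w) (fderiv ℝ (T t) w (w' - w))
        from rfl, ← integral_sub (hsub w') (hi (w' - w)),
      Real.norm_eq_abs, abs_of_nonneg (by positivity)]
    refine (norm_integral_Ioi_le_of_norm_le_exp hP.pos
      (c := (L + K * (4 * L / α)) * ‖w' - w‖ ^ 2) fun t ht => ?_).trans_eq (by ring)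
    have e1 : F (T t w') - F (T t w) - fderiv ℝ F (T t w) (fderiv ℝ (T t) w (w' - w)) =
        (F (T t w') - F (T t w) - fderiv ℝ F (T t w) (T t w' - T t w)) +
        fderiv ℝ F (T t w) (T t w' - T t w - fderiv ℝ (T t) w (w' - w)) := by
      simp only [map_sub]; abel
    have e2 : ‖F (T t w') - F (T t w) - fderiv ℝ F (T t w) (T t w' - T t w)‖ ≤
        L * (‖w' - w‖ * (‖w' - w‖ * Real.exp (-(α / 2) * t))) := by
      refine (hKL.norm_taylor_le hP.differentiable (hinv t ht _ hw2) (hinv t ht _ hw1)).trans ?_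
      rw [sq]
      have := hT.norm_sub_le hP ht w' w
      have := this.trans (mul_exp_neg_le hP.pos (norm_nonneg _) ht)
      gcongr
    have e3 : ‖fderiv ℝ F (T t w) (T t w' - T t w - fderiv ℝ (T t) w (w' - w))‖ ≤
        K * (4 * L / α * ‖w' - w‖ ^ 2 * Real.exp (-(α / 2) * t)) :=
      ContinuousLinearMap.le_of_opNorm_le_of_le _ (hKL.norm_fderiv_le _ (hinv t ht _ hw1))
        (hT.norm_taylor_le hP hKL hinv hw1 hw2 ht)
    rw [e1]
    refine (norm_add_le _ _).trans ((add_le_add e2 e3).trans_eq ?_)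
    ring
  refine hO.trans_isLittleO ?_
  have := (Asymptotics.isLittleO_norm_pow_id (E' := H) one_lt_two).comp_tendsto
    (tendsto_sub_nhds_zero_iff.2 (tendsto_id (x := 𝓝 w)))
  exact this

lemma norm_integral_fderiv_sub_le (hT : IsMildFlow S F T) (hP : IsCoerciveSemilinear A S F α)
    {s : Set H} {K L : ℝ} (hs : HasC11BoundsOn F s K L)
    (hinv : ∀ t, 0 ≤ t → ∀ w ∈ s, T t w ∈ s) {w w' : H} (hw : w ∈ s) (hw' : w' ∈ s) (h : H) :
    ‖(∫ t in Ioi (0 : ℝ), fderiv ℝ F (T t w') (fderiv ℝ (T t) w' h)) -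
        ∫ t in Ioi (0 : ℝ), fderiv ℝ F (T t w) (fderiv ℝ (T t) w h)‖ ≤
      (K * (4 * L / α) + L) * (2 / α) * ‖w' - w‖ * ‖h‖ := by
  have hα := hP.pos
  have hK := hs.nonneg_fst
  have hL := hs.nonneg_snd
  rw [← integral_sub (hT.integrableOn_fderiv_comp hP w' h) (hT.integrableOn_fderiv_comp hP w h)]
  refine (norm_integral_Ioi_le_of_norm_le_exp hP.pos
    (c := (K * (4 * L / α) + L) * ‖w' - w‖ * ‖h‖) fun t ht => ?_).trans_eq (by ring)
  have e1 : fderiv ℝ F (T t w') (fderiv ℝ (T t) w' h) - fderiv ℝ F (T t w) (fderiv ℝ (T t) w h) =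
      fderiv ℝ F (T t w') (fderiv ℝ (T t) w' h - fderiv ℝ (T t) w h) +
      (fderiv ℝ F (T t w') - fderiv ℝ F (T t w)) (fderiv ℝ (T t) w h) := by
    rw [map_sub, _root_.sub_apply]; abel
  have e2 : ‖fderiv ℝ F (T t w') (fderiv ℝ (T t) w' h - fderiv ℝ (T t) w h)‖ ≤
      K * (4 * L / α * ‖w' - w‖ * ‖h‖ * Real.exp (-(α / 2) * t)) :=
    ContinuousLinearMap.le_of_opNorm_le_of_le _ (hs.norm_fderiv_le _ (hinv t ht _ hw'))
      (hT.norm_fderiv_sub_le hP hs hinv hw hw' h ht)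
  have e3 : ‖(fderiv ℝ F (T t w') - fderiv ℝ F (T t w)) (fderiv ℝ (T t) w h)‖ ≤
      L * ‖w' - w‖ * (‖h‖ * Real.exp (-(α / 2) * t)) := by
    refine ContinuousLinearMap.le_of_opNorm_le_of_le _ ?_ (hT.norm_fderiv_apply_le hP ht w h)
    refine (hs.norm_fderiv_sub_le _ (hinv t ht _ hw') _ (hinv t ht _ hw)).trans ?_
    gcongr
    exact (hT.norm_sub_le hP ht w' w).trans (mul_exp_neg_le hP.pos (norm_nonneg _) ht)
  rw [e1]
  refine (norm_add_le _ _).trans ((add_le_add e2 e3).trans_eq ?_)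
  ring

lemma tendsto_zero (hT : IsMildFlow S F T) (hP : IsCoerciveSemilinear A S F α) (w : H) :
    Tendsto (fun t => T t w) atTop (𝓝 0) := by
  have h1 : Tendsto (fun t : ℝ => ‖w‖ * Real.exp (-(α / 2) * t)) atTop (𝓝 0) := by
    have := (Real.tendsto_exp_atBot.comp ((tendsto_id (α := ℝ)).const_mul_atTop_of_neg
      (by linarith [hP.pos] : -(α / 2) < 0))).const_mul ‖w‖
    rwa [mul_zero] at this
  refine squeeze_zero_norm' ?_ h1
  filter_upwards [eventually_ge_atTop 0] with t ht using hT.norm_le hP ht w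

/-- Along an orbit that starts in the domain, the integrand is minus the time derivative of
`F (T t w)`. -/
lemma integral_fderiv_apply_generator (hT : IsMildFlow S F T) (hP : IsCoerciveSemilinear A S F α)
    (w : A.domain) :
    ∫ t in Ioi (0 : ℝ), fderiv ℝ F (T t w) (fderiv ℝ (T t) w (A w + F w)) = F w := by
  have h1 := integral_Ioi_of_hasDerivAt_of_tendsto (a := 0) (m := 0)
    (f := fun t => -F (T t w))
    (f' := fun t => fderiv ℝ F (T t w) (fderiv ℝ (T t) w (A w + F w))) ?_ (fun t ht => ?_)
    (hT.integrableOn_fderiv_comp hP w _) ?_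
  · rwa [hT.zero, sub_neg_eq_add, zero_add] at h1
  · exact ((hP.differentiable.continuous.comp_continuousOn (hT.continuousOn (w : H))).neg 0
      self_mem_Ici)
  · have h2 := ((hP.differentiable (T t w)).hasFDerivAt.comp_hasDerivAt t
      (hT.hasDerivAt_apply hP w ht)).neg
    rw [IsMildFlow.velocity, max_eq_left (le_of_lt ht), map_neg, map_neg, neg_neg] at h2
    exact h2
  · have h2 := ((hP.differentiable.continuous.tendsto 0).comp (hT.tendsto_zero hP w)).neg
    rwa [hP.map_zero, neg_zero] at h2

/-- The integral of the equation along an orbit, with `R = A⁻¹` applied. For initial data in the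
domain this is the fundamental theorem of calculus, and both sides are continuous in `w`. -/
lemma integral_orbit_eq (hT : IsMildFlow S F T) (hP : IsCoerciveSemilinear A S F α)
    {R : H →L[ℝ] H} (hR : IsBoundedInverse A R) (w : H) {τ : ℝ} (hτ : 0 ≤ τ) :
    ∫ t in (0 : ℝ)..τ, T t w = R (w - T τ w - ∫ t in (0 : ℝ)..τ, F (T t w)) := by
  have hjc : Continuous fun p : H × ℝ => T (max p.2 0) p.1 :=
    continuous_prod_of_continuous_lipschitzWith _ 1 (fun w => (hT.mild w).continuous)
      fun t => LipschitzWith.of_dist_le_mul fun x y => by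
        simpa [dist_eq_norm] using (hT.norm_sub_le hP (le_max_right t 0) x y).trans
          (mul_exp_neg_le hP.pos (norm_nonneg _) (le_max_right t 0))
  have hFc := hP.differentiable.continuous
  have hTc : Continuous (T τ) := (hT.differentiable hP hτ).continuous
  have key : ∫ t in (0 : ℝ)..τ, T (max t 0) w =
      R (w - T τ w - ∫ t in (0 : ℝ)..τ, F (T (max t 0) w)) := by
    refine hP.semigroup.dense_domain.induction (P := fun w => ∫ t in (0 : ℝ)..τ, T (max t 0) w =
      R (w - T τ w - ∫ t in (0 : ℝ)..τ, F (T (max t 0) w))) (fun w hw => ?_)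
      (isClosed_eq ?_ ?_) w
    · have hv := hT.continuous_velocity hP ⟨w, hw⟩
      have hF := (hT.mild w).continuous_source
      have hnv : Continuous fun t => -velocity A F T ⟨w, hw⟩ t := hv.neg
      have hd : Continuous fun t => -velocity A F T ⟨w, hw⟩ t - F (T (max t 0) w) := hnv.sub hF
      have h1 := hT.apply_eq_add_integral_velocity hP ⟨w, hw⟩ hτ
      have h2 : w - T τ w - ∫ t in (0 : ℝ)..τ, F (T (max t 0) w) =
          ∫ t in (0 : ℝ)..τ, (-velocity A F T ⟨w, hw⟩ t - F (T (max t 0) w)) := by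
        rw [intervalIntegral.integral_sub (hnv.intervalIntegrable _ _)
          (hF.intervalIntegrable _ _), intervalIntegral.integral_neg, h1]
        abel
      rw [h2, ← ContinuousLinearMap.intervalIntegral_comp_comm _
        (hd.intervalIntegrable _ _)]
      refine intervalIntegral.integral_congr fun t ht => ?_
      rw [uIcc_of_le hτ] at ht
      obtain ⟨h3, h4⟩ := hT.apply_mem_domain hP ⟨w, hw⟩ ht.1
      simp only [max_eq_left ht.1]
      rw [← h4, hR.left_inv]
    · exact intervalIntegral.continuous_parametric_intervalIntegral_of_continuous'
        (f := fun w t => T (max t 0) w) hjc 0 τ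
    · have := intervalIntegral.continuous_parametric_intervalIntegral_of_continuous'
        (μ := volume) (f := fun w t => F (T (max t 0) w)) (hFc.comp hjc) 0 τ
      fun_prop
  have hmax : ∀ t ∈ uIcc 0 τ, max t 0 = t := fun t ht => by
    rw [uIcc_of_le hτ] at ht
    exact max_eq_left ht.1
  rw [intervalIntegral.integral_congr (f := fun t => T (max t 0) w)
      (g := fun t => T t w) fun t ht => by simp only [hmax t ht],
    intervalIntegral.integral_congr (f := fun t => F (T (max t 0) w))
      (g := fun t => F (T t w)) fun t ht => by simp only [hmax t ht]] at key
  exact key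

lemma tendsto_integral_orbit (hT : IsMildFlow S F T) (hP : IsCoerciveSemilinear A S F α)
    {R : H →L[ℝ] H} (hR : IsBoundedInverse A R) (w : H) :
    Tendsto (fun τ : ℝ => ∫ t in (0 : ℝ)..τ, T t w) atTop
      (𝓝 (R (w - ∫ t in Ioi (0 : ℝ), F (T t w)))) := by
  have h1 : Tendsto (fun τ : ℝ => R (w - T τ w - ∫ t in (0 : ℝ)..τ, F (T t w))) atTop
      (𝓝 (R (w - 0 - ∫ t in Ioi (0 : ℝ), F (T t w)))) :=
    (R.continuous.tendsto _).comp ((tendsto_const_nhds.sub (hT.tendsto_zero hP w)).sub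
      (intervalIntegral_tendsto_integral_Ioi 0 (hT.integrableOn_comp hP w) tendsto_id))
  rw [sub_zero] at h1
  refine h1.congr' ?_
  filter_upwards [eventually_ge_atTop 0] with τ hτ
  exact (hT.integral_orbit_eq hP hR w hτ).symm

end IsMildFlow

end TimeIntegral

/-! ### The output operator and the solution of the forwarding equation -/

section Forwarding

variable {H : Type*} [NormedAddCommGroup H] [InnerProductSpace ℝ H]
  {Z : Type*} [NormedAddCommGroup Z] [InnerProductSpace ℝ Z]
  {A : H →ₗ.[ℝ] H} {R : H →L[ℝ] H}

/-- For `C` bounded relative to `A`, the composition `C A⁻¹` is a bounded operator. -/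
lemma IsBoundedInverse.exists_comp (hR : IsBoundedInverse A R) (C : H →ₗ.[ℝ] Z)
    (hAC : A.domain ≤ C.domain) {a b : ℝ} (hb : 0 ≤ b)
    (hC : ∀ w : A.domain, ‖C ⟨w, hAC w.2⟩‖ ≤ a * ‖A w‖ + b * ‖(w : H)‖) :
    ∃ P : H →L[ℝ] Z, ∀ x, P x = C ⟨R x, hAC (hR.mem_domain x)⟩ := by
  refine ⟨LinearMap.mkContinuous
    { toFun := fun x => C ⟨R x, hAC (hR.mem_domain x)⟩
      map_add' := fun x y => by
        rw [← C.map_add]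
        congr 1
        exact Subtype.ext (map_add R x y)
      map_smul' := fun c x => by
        rw [RingHom.id_apply, ← C.map_smul]
        congr 1
        exact Subtype.ext (map_smul R c x) } (a + b * ‖R‖) fun x => ?_, fun x => rfl⟩
  have h1 := hC ⟨R x, hR.mem_domain x⟩
  rw [hR.right_inv] at h1
  refine h1.trans ?_
  rw [add_mul, mul_assoc]
  gcongr
  exact R.le_opNorm x

end Forwarding

theorem theorem3
    {H : Type*} [NormedAddCommGroup H] [InnerProductSpace ℝ H] [CompleteSpace H]
    {Z : Type*} [NormedAddCommGroup Z] [InnerProductSpace ℝ Z] [CompleteSpace Z]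
    -- `-A` generates a strongly continuous linear semigroup `S`
    (A : H →ₗ.[ℝ] H) (S : ℝ → H →L[ℝ] H) (hS : IsC0SemigroupWithNegGenerator A S)
    -- the nonlinearity
    (F : H → H) (hF : ContDiff ℝ 1 F) (hdF : LipschitzOnBounded (fderiv ℝ F)) (hF0 : F 0 = 0)
    -- the output operator `C` is `A`-bounded
    (C : H →ₗ.[ℝ] Z) (hAC : A.domain ≤ C.domain)
    (a b : ℝ) (ha : 0 < a) (hb : 0 < b)
    (hC : ∀ w : A.domain, ‖C ⟨w, hAC w.2⟩‖ ≤ a * ‖A w‖ + b * ‖(w : H)‖)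
    -- `0` is in the resolvent set of `A`, with `R = A⁻¹`
    (R : H →L[ℝ] H) (hR : IsBoundedInverse A R)
    -- uniform coercivity of `A + dF(w)`
    (α : ℝ) (hα : 0 < α)
    (hcoer : ∀ (w : H) (h : A.domain),
      α * ‖(h : H)‖ ^ 2 ≤ inner ℝ (A h + fderiv ℝ F w (h : H)) (h : H)) :
    -- `-(A + F)` generates a contraction semigroup `T`, and for this semigroup:
    (∃ T : ℝ → H → H, IsContractionSemigroupGeneratedByNeg (semilinearOp A F) T) ∧
    ∀ T : ℝ → H → H, IsContractionSemigroupGeneratedByNeg (semilinearOp A F) T →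
      ∃ M : H → Z,
        -- `M` is a `C¹` solution of the forwarding equation, with `dM` locally Lipschitz
        ContDiff ℝ 1 M ∧
        M 0 = 0 ∧
        (∀ w : A.domain, fderiv ℝ M w (A w + F w) + C ⟨w, hAC w.2⟩ = 0) ∧
        LipschitzOnBounded (fderiv ℝ M) ∧
        -- `M w = -C (lim ∫₀^τ T_t w dt) = -C A⁻¹ w + C A⁻¹ ∫₀^∞ F (T_t w) dt`
        (∀ w : H, ∃ (x : H) (hx : x ∈ A.domain),
          Tendsto (fun τ : ℝ => ∫ t in (0 : ℝ)..τ, T t w) atTop (𝓝 x) ∧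
          M w = -C ⟨x, hAC hx⟩) ∧
        (∀ w : H, IntegrableOn (fun t : ℝ => F (T t w)) (Ioi 0) ∧
          M w = -C ⟨R w, hAC (hR.mem_domain w)⟩
            + C ⟨R (∫ t in Ioi (0 : ℝ), F (T t w)), hAC (hR.mem_domain _)⟩) ∧
        -- each `T_t` is differentiable, and the formula for `dM`
        (∀ t : ℝ, 0 ≤ t → Differentiable ℝ (T t)) ∧
        (∀ w h : H,
          IntegrableOn (fun t : ℝ => fderiv ℝ F (T t w) (fderiv ℝ (T t) w h)) (Ioi 0) ∧
          fderiv ℝ M w h = -C ⟨R h, hAC (hR.mem_domain h)⟩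
            + C ⟨R (∫ t in Ioi (0 : ℝ), fderiv ℝ F (T t w) (fderiv ℝ (T t) w h)),
                hAC (hR.mem_domain _)⟩) ∧
        -- if `F` and `dF` are globally Lipschitz, so is `dM`
        ((∃ K : ℝ≥0, LipschitzWith K F) → (∃ K : ℝ≥0, LipschitzWith K (fderiv ℝ F)) →
          ∃ K : ℝ≥0, LipschitzWith K (fderiv ℝ M)) := by
  have hP : IsCoerciveSemilinear A S F α := ⟨hS, hα, hF, hdF, hF0, hcoer⟩
  refine ⟨?_, fun T hgen => ?_⟩
  · obtain ⟨T, hT⟩ := hP.exists_isMildFlow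
    exact ⟨T, hT.isContractionSemigroup hP⟩
  have hT := hgen.isMildFlow hP
  obtain ⟨P, hPC⟩ := hR.exists_comp C hAC hb.le hC
  choose Q hQ hQd using hT.hasFDerivAt_integral hP
  set M : H → Z := fun w => P (-w + ∫ t in Ioi (0 : ℝ), F (T t w)) with hM
  have hMd : ∀ w, HasFDerivAt M (P.comp (-ContinuousLinearMap.id ℝ H + Q w)) w := fun w =>
    P.hasFDerivAt.comp w ((hasFDerivAt_id w).neg.add (hQd w))
  have hfM : ∀ w, fderiv ℝ M w = P.comp (-ContinuousLinearMap.id ℝ H + Q w) := fun w =>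
    (hMd w).fderiv
  -- a Lipschitz estimate for `dM`, on balls and on the whole space alike
  have hLip : ∀ {s : Set H} {K L : ℝ}, HasC11BoundsOn F s K L →
      (∀ t, 0 ≤ t → ∀ w ∈ s, T t w ∈ s) → ∃ N : ℝ≥0, LipschitzOnWith N (fderiv ℝ M) s := by
    intro s K L hs hinv
    have hK := hs.nonneg_fst
    have hL := hs.nonneg_snd
    refine ⟨‖P‖₊ * ((K * (4 * L / α) + L) * (2 / α)).toNNReal,
      LipschitzOnWith.of_dist_le_mul fun w' hw' w hw => ?_⟩
    have h1 : ‖Q w' - Q w‖ ≤ (K * (4 * L / α) + L) * (2 / α) * ‖w' - w‖ := by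
      refine ContinuousLinearMap.opNorm_le_bound _ (by positivity) fun h => ?_
      rw [_root_.sub_apply, hQ, hQ]
      exact hT.norm_integral_fderiv_sub_le hP hs hinv hw hw' h
    rw [dist_eq_norm, dist_eq_norm, hfM, hfM, ← ContinuousLinearMap.comp_sub,
      add_sub_add_left_eq_sub, NNReal.coe_mul, Real.coe_toNNReal _ (by positivity), mul_assoc]
    refine (ContinuousLinearMap.opNorm_comp_le _ _).trans ?_
    rw [coe_nnnorm]
    gcongr
  have hLB : LipschitzOnBounded (fderiv ℝ M) := by
    intro s hs
    obtain ⟨r, hr⟩ := hs.subset_closedBall 0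
    obtain ⟨K, L, hKL⟩ := hdF.exists_hasC11BoundsOn r
    obtain ⟨N, hN⟩ := hLip hKL fun t ht w hw => hT.mem_closedBall hP ht hw
    exact ⟨N, hN.mono hr⟩
  refine ⟨M, ?_, ?_, fun w => ?_, hLB, fun w => ?_, fun w => ⟨hT.integrableOn_comp hP w, ?_⟩,
    fun t ht => hT.differentiable hP ht, fun w h => ⟨hT.integrableOn_fderiv_comp hP w h, ?_⟩, ?_⟩
  · refine contDiff_one_iff_fderiv.2 ⟨fun w => (hMd w).differentiableAt,
      continuous_iff_continuousAt.2 fun w => ?_⟩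
    obtain ⟨N, hN⟩ := hLB _ (Metric.isBounded_ball (x := w) (r := 1))
    exact hN.continuousOn.continuousAt (Metric.ball_mem_nhds w one_pos)
  · have : ∫ t in Ioi (0 : ℝ), F (T t 0) = 0 := by
      rw [setIntegral_congr_fun (g := fun _ => (0 : H)) measurableSet_Ioi fun t ht => by
        simp only [hT.map_zero hP (le_of_lt ht), hF0]]
      simp
    simp [hM, this]
  · have h1 : P (A w) = C ⟨w, hAC w.2⟩ := by
      rw [hPC]
      congr 1
      exact Subtype.ext (hR.left_inv w)
    rw [hfM, ← h1, ContinuousLinearMap.comp_apply, _root_.add_apply, hQ,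
      hT.integral_fderiv_apply_generator hP w, ← map_add]
    simp
  · refine ⟨_, hR.mem_domain _, hT.tendsto_integral_orbit hP hR w, ?_⟩
    rw [← hPC, ← map_neg, hM, neg_sub', sub_neg_eq_add]
  · rw [← hPC, ← hPC, hM, ← map_neg, ← map_add]
  · rw [← hPC, ← hPC, hfM, ContinuousLinearMap.comp_apply, _root_.add_apply, hQ, ← map_neg,
      ← map_add]
    simp
  · rintro ⟨K, hK⟩ ⟨L, hL⟩
    obtain ⟨N, hN⟩ := hLip (s := univ) (K := K) (L := L)
      ⟨convex_univ, K.2, L.2, fun x _ => norm_fderiv_le_of_lipschitz ℝ hK, fun x _ y _ => by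
        simpa only [dist_eq_norm] using hL.dist_le_mul x y⟩ fun _ _ _ _ => mem_univ _
    exact ⟨N, lipschitzOnWith_univ.1 hN⟩
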